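/- Let $(M,g_M)$ be a connected smooth Riemannian manifold of dimension $n$ and equip $M\times\mathbb R$ with the Lorentzian product metric $\bar g=g_M-dt^2$. Let $\Sigma$ be a non-empty smooth $n$-manifold and $F:\Sigma\to M\times\mathbb R$ an immersed spacelike hypersurface, i.e. a smooth immersion such that $g=F^*\bar g$ is positive definite. (Manifolds are Hausdorff and without boundary. A Riemannian metric is called complete if Cauchy sequences for its Riemannian distance converge, points of different components being at infinite distance; $\Sigma$ is called complete if $g$ is.) Let $\Pi:\Sigma\to M$ be the first component of $F$. (1) If $g_M$ is incomplete, then $\Sigma$ is incomplete. (2) If $g_M$ is complete and $F$ is proper, then $\Pi:\Sigma\to M$ is a (smooth, surjective) covering map, that is, a surjective local diffeomorphism and a covering map. Moreover, let $p:\tilde M\to M$ and $q:\tilde\Sigma\to\Sigma$ be any smooth universal coverings (surjective covering maps and local diffeomorphisms from simply connected smooth manifolds), and equip $\tilde M$ with $p^*g_M$. Then there is a continuous lift $G:\tilde\Sigma\to\tilde M\times\mathbb R$ of $F\circ q$, i.e. $(p\times\mathrm{id}_{\mathbb R})\circ G=F\circ q$; and for each such lift $G$: it is an immersed spacelike hypersurface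 of $(\tilde M\times\mathbb R,\,p^*g_M-dt^2)$, its first component is a diffeomorphism $\tilde\Sigma\to\tilde M$, and its image is the graph $\{(x,u(x)):x\in\tilde M\}$ of a smooth function $u:\tilde M\to\mathbb R$ whose graph is spacelike. Finally, $\Sigma$ is complete if and only if this graph is complete, i.e. if and only if the metric induced on $\tilde M$ from $p^*g_M-dt^2$ by $x\mapsto(x,u(x))$, which is $p^*g_M-du^2$, is complete. -/

import Mathlib

open scoped Manifold ContDiff Bundle Topology

noncomputable section

namespace LorentzProduct

/-- A Riemannian metric (a scalar product on every tangent space) on an `n`-manifold. Smoothness in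
the base point is not part of this type: it is required of the given metric on `M`, and it is
automatic for the metrics obtained below by pulling back along smooth maps. -/
abbrev TangentMetric (n : ℕ) (M : Type*) [TopologicalSpace M]
    [ChartedSpace (EuclideanSpace ℝ (Fin n)) M] : Type _ :=
  Bundle.RiemannianMetric (fun x : M => TangentSpace (𝓡 n) x)

/-- In finite dimension a positive definite form has bounded unit ball. -/
theorem isVonNBounded_of_pos {E : Type*} [NormedAddCommGroup E] [NormedSpace ℝ E]
    [FiniteDimensional ℝ E] (b : E →L[ℝ] E →L[ℝ] ℝ) (pos : ∀ v, v ≠ 0 → 0 < b v v) :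
    Bornology.IsVonNBounded ℝ {v : E | b v v < 1} := by
  rw [NormedSpace.isVonNBounded_iff]
  have hcont : Continuous fun v : E => b v v := by fun_prop
  rcases (Metric.sphere (0 : E) 1).eq_empty_or_nonempty with hS | hS
  · have h0 : ∀ v : E, v = 0 := by
      intro v
      by_contra hv
      have : ‖v‖⁻¹ • v ∈ Metric.sphere (0 : E) 1 := by
        simp [norm_smul, norm_ne_zero_iff.mpr hv]
      simp [hS] at this
    exact (Bornology.isBounded_singleton (x := (0 : E))).subset (fun v _ => h0 v)
  · obtain ⟨w, hw, hmin⟩ := (isCompact_sphere (0 : E) 1).exists_isMinOn hS hcont.continuousOn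
    have hw1 : ‖w‖ = 1 := by simpa using hw
    have hw0 : w ≠ 0 := by
      intro h
      simp [h] at hw1
    have hm : 0 < b w w := pos w hw0
    refine (Metric.isBounded_closedBall (x := (0 : E)) (r := 1 + (b w w)⁻¹)).subset ?_
    intro v hv
    have hv1 : b v v < 1 := hv
    rw [mem_closedBall_zero_iff]
    by_cases hv0 : v = 0
    · subst hv0
      simp
      positivity
    have hn : 0 < ‖v‖ := norm_pos_iff.mpr hv0
    have hu : ‖v‖⁻¹ • v ∈ Metric.sphere (0 : E) 1 := by
      simp [norm_smul, hn.ne']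
    have h1 : b w w ≤ ‖v‖⁻¹ * (‖v‖⁻¹ * b v v) := by
      have := hmin hu
      simpa using this
    have h2 : b w w * ‖v‖ ^ 2 ≤ b v v := by
      calc b w w * ‖v‖ ^ 2 ≤ (‖v‖⁻¹ * (‖v‖⁻¹ * b v v)) * ‖v‖ ^ 2 := by gcongr
        _ = b v v := by field_simp
    have h3 : ‖v‖ ^ 2 ≤ (b w w)⁻¹ := by
      rw [← one_div, le_div_iff₀ hm]
      linarith
    nlinarith [sq_nonneg (‖v‖ - 1), inv_pos.mpr hm]

/-- The pullback `(v, w) ↦ b (f v) (f w)` of a bilinear form. -/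
def pullForm {V W : Type*} [AddCommGroup V] [Module ℝ V] [TopologicalSpace V]
    [IsTopologicalAddGroup V] [ContinuousSMul ℝ V]
    [AddCommGroup W] [Module ℝ W] [TopologicalSpace W]
    [IsTopologicalAddGroup W] [ContinuousSMul ℝ W]
    (b : W →L[ℝ] W →L[ℝ] ℝ) (f : V →L[ℝ] W) : V →L[ℝ] V →L[ℝ] ℝ :=
  ((ContinuousLinearMap.precomp ℝ f).comp b).comp f

section Metrics

variable {n : ℕ} {M : Type*} [TopologicalSpace M] [ChartedSpace (EuclideanSpace ℝ (Fin n)) M]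
  {S : Type*} [TopologicalSpace S] [ChartedSpace (EuclideanSpace ℝ (Fin n)) S]

/-- The Riemannian metric given by a symmetric, positive definite 2-tensor. -/
def TangentMetric.ofPosDef
    (b : ∀ x : S, TangentSpace (𝓡 n) x →L[ℝ] TangentSpace (𝓡 n) x →L[ℝ] ℝ)
    (symm : ∀ x v w, b x v w = b x w v) (pos : ∀ x v, v ≠ 0 → 0 < b x v v) :
    TangentMetric n S where
  inner := b
  symm := symm
  pos := pos
  continuousAt x := by
    have : Continuous fun v : EuclideanSpace ℝ (Fin n) =>
        (show EuclideanSpace ℝ (Fin n) →L[ℝ] EuclideanSpace ℝ (Fin n) →L[ℝ] ℝ from b x) v v := by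
      fun_prop
    exact this.continuousAt
  isVonNBounded x := isVonNBounded_of_pos (E := EuclideanSpace ℝ (Fin n)) (b x) (pos x)

/-- The Riemannian metric `g` is complete: every Cauchy sequence for the Riemannian distance (the
infimum of the `g`-lengths of `C¹` curves, `∞` between different components) converges. -/
def IsCompleteMetric (g : TangentMetric n M) : Prop :=
  letI : Bundle.RiemannianBundle (fun x : M => TangentSpace (𝓡 n) x) := ⟨g⟩
  ∀ s : ℕ → M,
    (∀ ε : ENNReal, 0 < ε → ∃ N : ℕ, ∀ i ≥ N, ∀ j ≥ N,
      Manifold.riemannianEDist (𝓡 n) (s i) (s j) < ε) →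
    ∃ x : M, Filter.Tendsto (fun i => Manifold.riemannianEDist (𝓡 n) (s i) x) Filter.atTop (𝓝 0)

/-- The Lorentzian product metric `g - dt²` on `M × ℝ`: the pullback of `g` under the first
projection minus the square of the differential of the second projection. -/
def lorentzMetric (g : TangentMetric n M) (z : M × ℝ) :
    TangentSpace ((𝓡 n).prod 𝓘(ℝ, ℝ)) z →L[ℝ] TangentSpace ((𝓡 n).prod 𝓘(ℝ, ℝ)) z →L[ℝ] ℝ :=
  pullForm (g.inner z.1) (mfderiv ((𝓡 n).prod 𝓘(ℝ, ℝ)) (𝓡 n) (Prod.fst : M × ℝ → M) z)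
    - pullForm (ContinuousLinearMap.mul ℝ ℝ)
      ((NormedSpace.fromTangentSpace (𝕜 := ℝ) z.2).toContinuousLinearMap.comp
        (mfderiv ((𝓡 n).prod 𝓘(ℝ, ℝ)) 𝓘(ℝ, ℝ) (Prod.snd : M × ℝ → ℝ) z))

theorem lorentzMetric_symm (g : TangentMetric n M) (z : M × ℝ)
    (v w : TangentSpace ((𝓡 n).prod 𝓘(ℝ, ℝ)) z) :
    lorentzMetric g z v w = lorentzMetric g z w v :=
  congrArg₂ (fun a b : ℝ => a - b) (g.symm _ _ _) (mul_comm (G := ℝ) _ _)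

/-- The first fundamental form `F^*(g - dt²)` of a map `F : S → M × ℝ`. -/
def inducedForm (g : TangentMetric n M) (F : S → M × ℝ) (s : S) :
    TangentSpace (𝓡 n) s →L[ℝ] TangentSpace (𝓡 n) s →L[ℝ] ℝ :=
  pullForm (lorentzMetric g (F s)) (mfderiv (𝓡 n) ((𝓡 n).prod 𝓘(ℝ, ℝ)) F s)

theorem inducedForm_symm (g : TangentMetric n M) (F : S → M × ℝ) (s : S)
    (v w : TangentSpace (𝓡 n) s) : inducedForm g F s v w = inducedForm g F s w v :=
  lorentzMetric_symm g (F s) _ _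

/-- `F : S → M × ℝ` is an immersed spacelike hypersurface of `(M × ℝ, g - dt²)`: a smooth immersion
of an `n`-manifold (`n = dim M`) whose induced form is positive definite. -/
structure IsSpacelikeImmersion (g : TangentMetric n M) (F : S → M × ℝ) : Prop where
  smooth : ContMDiff (𝓡 n) ((𝓡 n).prod 𝓘(ℝ, ℝ)) ∞ F
  immersion : ∀ s : S, Function.Injective (mfderiv (𝓡 n) ((𝓡 n).prod 𝓘(ℝ, ℝ)) F s)
  spacelike : ∀ (s : S) (v : TangentSpace (𝓡 n) s), v ≠ 0 → 0 < inducedForm g F s v v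

/-- The Riemannian metric induced on an immersed spacelike hypersurface. -/
def IsSpacelikeImmersion.inducedMetric {g : TangentMetric n M} {F : S → M × ℝ}
    (hF : IsSpacelikeImmersion g F) : TangentMetric n S :=
  TangentMetric.ofPosDef (inducedForm g F) (inducedForm_symm g F) hF.spacelike

/-- `p : S → M` is a (smooth) universal covering: a surjective covering map and smooth local
diffeomorphism with simply connected total space. -/
structure IsUniversalCovering (n : ℕ) {M : Type*} [TopologicalSpace M]
    [ChartedSpace (EuclideanSpace ℝ (Fin n)) M] {S : Type*} [TopologicalSpace S]
    [ChartedSpace (EuclideanSpace ℝ (Fin n)) S] (p : S → M) : Prop where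
  isCoveringMap : IsCoveringMap p
  surjective : Function.Surjective p
  isLocalDiffeomorph : IsLocalDiffeomorph (𝓡 n) (𝓡 n) ∞ p
  simplyConnected : SimplyConnectedSpace S

/-- The pullback `p^* g` of a metric on `M` to a universal covering of `M`. -/
def IsUniversalCovering.pullbackMetric {p : S → M} (hp : IsUniversalCovering n p)
    (g : TangentMetric n M) : TangentMetric n S :=
  TangentMetric.ofPosDef
    (fun x => pullForm (g.inner (p x)) (mfderiv (𝓡 n) (𝓡 n) p x))
    (fun x v w => g.symm _ _ _)
    (fun x v hv => by
      refine g.pos _ _ fun h => hv ?_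
      have e := hp.isLocalDiffeomorph.mfderivToContinuousLinearEquiv_coe (by simp) x
      rw [← e] at h
      exact (ContinuousLinearEquiv.map_eq_zero_iff _).mp h)

/-- `G : S' → M' × ℝ` is a lift of the hypersurface `F : S → M × ℝ` to the coverings `q : S' → S`
and `p : M' → M`, that is, `(p × id) ∘ G = F ∘ q`. -/
structure IsLift {S' M' : Type*} [TopologicalSpace S'] [TopologicalSpace M']
    (F : S → M × ℝ) (q : S' → S) (p : M' → M) (G : S' → M' × ℝ) : Prop where
  continuous : Continuous G
  comm : ∀ s, (p (G s).1, (G s).2) = F (q s)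

end Metrics

end LorentzProduct

end

noncomputable section

namespace LorentzProduct

/-! ### Path lifting through local homeomorphisms, and a criterion for even covering. -/

section Topological

open Set Filter Topology

variable {E X : Type*} [TopologicalSpace E]

/-! Write τ for the second component of F, so that the induced metric is g = Π^*g_M - dτ².
Positivity of g gives two estimates: g ≤ Π^*g_M (`inducedMetric_le`) and dτ² ≤ Π^*g_M
(`sq_realDiff_le`). By the first, dΠ is injective, so Π is a local diffeomorphism.

The heart is that Π lifts C¹ paths. By `exists_isPathLiftOn_of_mapClusterPt`, a lift over [0, b) can
be continued once it has a cluster point at b. If Σ is complete, g ≤ Π^*g_M makes the lift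
Lipschitz, so it converges along a sequence tending to b (`liftsSmoothPaths_of_isCompleteMetric`).
If F is proper, the bound on dτ keeps the lift in a compact set
(`IsSpacelikeImmersion.liftsSmoothPaths`). Lifting the radial segments of a coordinate ball then
shows that Π is a covering (`LiftsSmoothPaths.isCoveringMap`).

Part (1) is proved by contraposition. If Σ is complete, Π is a surjective covering along which lifts
of paths are no longer than the paths. Hence a Cauchy sequence in M has a subsequence lifting to a
Cauchy sequence in Σ, and its limit projects to the limit sought
(`IsCompleteMetric.of_liftsSmoothPaths`).

For part (2), uniqueness of lifts makes the first component of G a homeomorphism, with inverse k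
(`exists_inverse_of_comp_eq`); put u = τ ∘ q ∘ k. The graph map of u is itself a lift of F, along
the covering q ∘ k, so the graph metric is (q ∘ k)^*g. Completeness descends along this covering by
the lemma above and ascends by `IsCompleteMetric.of_isCoveringMap`. -/

/-- `σ` is a continuous lift of `γ` along `p` over the set `s`, starting at `e` at time `0`. -/
structure IsPathLiftOn (p : E → X) (γ : ℝ → X) (e : E) (s : Set ℝ) (σ : ℝ → E) : Prop where
  continuousOn : ContinuousOn σ s
  lifts : ∀ t ∈ s, p (σ t) = γ t
  zero : σ 0 = e

theorem IsPathLiftOn.mono {p : E → X} {γ : ℝ → X} {e : E} {s t : Set ℝ} {σ : ℝ → E}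
    (h : IsPathLiftOn p γ e s σ) (hst : t ⊆ s) : IsPathLiftOn p γ e t σ :=
  ⟨h.continuousOn.mono hst, fun _ ht => h.lifts _ (hst ht), h.zero⟩

variable [TopologicalSpace X]

/-- A lift over `[0, t]` extends over `[0, b]` if the rest of the path stays in the target of a
local inverse near the current end point. -/
theorem IsPathLiftOn.extend {p : E → X} {γ : ℝ → X} {e : E} {t b : ℝ} {σ : ℝ → E}
    (h : IsPathLiftOn p γ e (Icc 0 t) σ) (ht : 0 ≤ t)
    (hγ : ContinuousOn γ (Icc t b)) (φ : OpenPartialHomeomorph E X) (hφ : p = φ)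
    (hσ : σ t ∈ φ.source) (htgt : ∀ u ∈ Icc t b, γ u ∈ φ.target) :
    ∃ σ', IsPathLiftOn p γ e (Icc 0 b) σ' := by
  classical
  have hjoin : σ t = φ.symm (γ t) := by
    rw [← h.lifts t ⟨ht, le_rfl⟩, hφ, φ.left_inv hσ]
  refine ⟨fun u => if u ≤ t then σ u else φ.symm (γ u), ?_, ?_, ?_⟩
  · refine ContinuousOn.if ?_ ?_ ?_
    · rintro u ⟨-, hu⟩
      have : u = t := frontier_Iic_subset t hu
      rw [this, hjoin]
    · refine h.continuousOn.mono ?_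
      rintro u ⟨hu, hut⟩
      rw [closure_le_eq continuous_id' continuous_const] at hut
      exact ⟨hu.1, hut⟩
    · have hsub : Icc 0 b ∩ closure {a | ¬ a ≤ t} ⊆ Icc t b := by
        rintro u ⟨hu, hut⟩
        simp_rw [not_le] at hut
        exact ⟨closure_lt_subset_le continuous_const continuous_id' hut, hu.2⟩
      exact (φ.continuousOn_symm.comp hγ htgt).mono hsub
  · intro u hu
    split_ifs with hut
    · exact h.lifts u ⟨hu.1, hut⟩
    · rw [hφ, φ.right_inv (htgt u ⟨(not_le.mp hut).le, hu.2⟩)]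
  · simp [ht, h.zero]

/-- Lifts over `[0, b]` with the same starting point agree. -/
theorem IsPathLiftOn.eqOn [T2Space E] {p : E → X} (hp : IsLocalHomeomorph p) {γ : ℝ → X} {e : E}
    {b : ℝ} (hb : 0 ≤ b) {σ τ : ℝ → E} (h : IsPathLiftOn p γ e (Icc 0 b) σ)
    (h' : IsPathLiftOn p γ e (Icc 0 b) τ) : EqOn σ τ (Icc 0 b) :=
  (T2Space.isSeparatedMap p).eqOn_of_comp_eqOn hp.isLocallyInjective isPreconnected_Icc
    h.continuousOn h'.continuousOn
    (fun t ht => (h.lifts t ht).trans (h'.lifts t ht).symm) ⟨le_rfl, hb⟩ (h.zero.trans h'.zero.symm)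

/-- A path lifts through a local homeomorphism if every lift over a half-open interval has a cluster
point at the open end. -/
theorem exists_isPathLiftOn_of_mapClusterPt [T2Space E] [T2Space X] {p : E → X}
    (hp : IsLocalHomeomorph p) {γ : ℝ → X} (hγ : ContinuousOn γ (Icc 0 1)) {e : E}
    (he : p e = γ 0)
    (hcl : ∀ b ∈ Ioc (0 : ℝ) 1, ∀ σ, IsPathLiftOn p γ e (Ico 0 b) σ →
      ∃ y, MapClusterPt y (𝓝[<] b) σ) :
    ∃ σ, IsPathLiftOn p γ e (Icc 0 1) σ := by
  set A : Set ℝ := {b | ∃ σ, IsPathLiftOn p γ e (Icc 0 b) σ} with hA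
  have hdown : ∀ b ∈ A, ∀ c ≤ b, c ∈ A := fun b ⟨σ, hσ⟩ c hc =>
    ⟨σ, hσ.mono (Icc_subset_Icc_right hc)⟩
  have h0 : (0 : ℝ) ∈ A := by
    refine ⟨fun _ => e, continuousOn_const, fun t ht => ?_, rfl⟩
    have : t = 0 := le_antisymm ht.2 ht.1
    rw [this, he]
  -- the set of times up to which a lift exists is closed
  have hlim : ∀ b ∈ Ioc (0 : ℝ) 1, (∀ c ∈ Ico 0 b, c ∈ A) → b ∈ A := by
    intro b hb hc
    have : Nonempty (ℝ → E) := ⟨fun _ => e⟩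
    choose! τ hτ using hc
    have hτeq : ∀ c ∈ Ico 0 b, ∀ t ∈ Icc 0 c, τ t t = τ c t := fun c hc t ht =>
      IsPathLiftOn.eqOn hp ht.1 (hτ t ⟨ht.1, ht.2.trans_lt hc.2⟩)
        ((hτ c hc).mono (Icc_subset_Icc_right ht.2)) ⟨ht.1, le_rfl⟩
    -- By uniqueness the chosen lifts are compatible, so their diagonal is one lift over the
    -- half-open interval.
    have hσ : IsPathLiftOn p γ e (Ico 0 b) (fun t => τ t t) := by
      refine ⟨fun t ht => ?_, fun t ht => (hτ t ht).lifts t ⟨ht.1, le_rfl⟩,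
        (hτ 0 ⟨le_rfl, hb.1⟩).zero⟩
      obtain ⟨c, htc, hcb⟩ := exists_between ht.2
      have hc : c ∈ Ico 0 b := ⟨ht.1.trans htc.le, hcb⟩
      have h1 : ContinuousWithinAt (τ c) (Icc 0 c) t := (hτ c hc).continuousOn t ⟨ht.1, htc.le⟩
      have h2 : ContinuousWithinAt (fun t => τ t t) (Icc 0 c) t :=
        h1.congr (fun s hs => hτeq c hc s hs) (hτeq c hc t ⟨ht.1, htc.le⟩)
      refine h2.mono_of_mem_nhdsWithin ?_
      filter_upwards [self_mem_nhdsWithin, mem_nhdsWithin_of_mem_nhds (Iio_mem_nhds htc)]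
        with s hs hs' using ⟨hs.1, le_of_lt hs'⟩
    obtain ⟨y, hy⟩ := hcl b hb _ hσ
    have hmem : Ioo 0 b ∈ 𝓝[<] b := Ioo_mem_nhdsLT hb.1
    -- The composite `p ∘ σ` equals `γ` and converges to `γ b`; in a Hausdorff space this limit is
    -- its only cluster point.
    have hpy : p y = γ b := by
      have h1 : MapClusterPt (p y) (𝓝[<] b) (p ∘ fun t => τ t t) :=
        hy.continuousAt_comp hp.continuous.continuousAt
      have h2 : Tendsto (p ∘ fun t => τ t t) (𝓝[<] b) (𝓝 (γ b)) := by
        have h3 : Tendsto γ (𝓝[Icc 0 1] b) (𝓝 (γ b)) := hγ b ⟨hb.1.le, hb.2⟩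
        have h4 : 𝓝[<] b ≤ 𝓝[Icc 0 1] b := by
          refine nhdsWithin_le_of_mem ?_
          filter_upwards [hmem] with t ht using ⟨ht.1.le, ht.2.le.trans hb.2⟩
        refine (h3.mono_left h4).congr' ?_
        filter_upwards [hmem] with t ht using (hσ.lifts t ⟨ht.1.le, ht.2⟩).symm
      exact eq_of_nhds_neBot (h1.clusterPt.mono h2)
    obtain ⟨φ, hyφ, hφ⟩ := hp y
    have htgt : ∀ᶠ t in 𝓝[Icc 0 1] b, γ t ∈ φ.target :=
      (hγ b ⟨hb.1.le, hb.2⟩) (φ.open_target.mem_nhds (by rw [← hpy, hφ]; exact φ.map_source hyφ))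
    obtain ⟨δ, hδ, hsub⟩ := Metric.mem_nhdsWithin_iff.mp htgt
    -- The lift enters the source of `φ` at times arbitrarily close to `b`. From such a time on, `γ`
    -- stays in the target, and the local inverse carries the lift past the gap.
    have hfr := hy.frequently (φ.open_source.mem_nhds hyφ)
    have hev : ∀ᶠ t in 𝓝[<] b, t ∈ Ioo (max 0 (b - δ)) b :=
      Ioo_mem_nhdsLT (max_lt hb.1 (by linarith))
    obtain ⟨t, htφ, ht⟩ := (hfr.and_eventually hev).exists
    have ht0 : 0 < t := (le_max_left _ _).trans_lt ht.1
    have htδ : b - δ < t := (le_max_right _ _).trans_lt ht.1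
    refine (hσ.mono fun u hu => ⟨hu.1, hu.2.trans_lt ht.2⟩ :
      IsPathLiftOn p γ e (Icc 0 t) _).extend ht0.le
        (hγ.mono (Icc_subset_Icc ht0.le hb.2)) φ hφ htφ fun u hu => hsub ⟨?_, ?_⟩
    · rw [Metric.mem_ball, Real.dist_eq, abs_lt]
      constructor <;> linarith [hu.1, hu.2]
    · exact ⟨ht0.le.trans hu.1, hu.2.trans hb.2⟩
  have hclosed : IsClosed (A ∩ Icc 0 1) := by
    refine isClosed_of_closure_subset fun b hb => ?_
    have hb1 : b ∈ Icc (0 : ℝ) 1 := closure_minimal inter_subset_right isClosed_Icc hb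
    refine ⟨?_, hb1⟩
    rcases hb1.1.eq_or_lt with h | h
    · exact h ▸ h0
    refine hlim b ⟨h, hb1.2⟩ fun c hc => ?_
    obtain ⟨d, hd, hdA⟩ := mem_closure_iff.mp hb (Ioi c) isOpen_Ioi hc.2
    exact hdown d hdA.1 c (le_of_lt hd)
  -- Continuous induction: it remains to prolong a lift slightly beyond any time `t < 1`.
  refine (hclosed.Icc_subset_of_forall_exists_gt h0 ?_) (right_mem_Icc.mpr zero_le_one)
  rintro t ⟨⟨σ, hσ⟩, ht⟩ c hc
  obtain ⟨φ, hφs, hφ⟩ := hp (σ t)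
  have htgt : ∀ᶠ u in 𝓝[Icc 0 1] t, γ u ∈ φ.target :=
    (hγ t ⟨ht.1, ht.2.le⟩) (φ.open_target.mem_nhds (by
      rw [← hσ.lifts t ⟨ht.1, le_rfl⟩, hφ]; exact φ.map_source hφs))
  obtain ⟨δ, hδ, hsub⟩ := Metric.mem_nhdsWithin_iff.mp htgt
  obtain ⟨d, htd, hd⟩ := exists_between (lt_min (lt_min (hc : t < c) ht.2) (by linarith : t < t + δ))
  have hdc : d < c := hd.trans_le ((min_le_left _ _).trans (min_le_left _ _))
  have hd1 : d < 1 := hd.trans_le ((min_le_left _ _).trans (min_le_right _ _))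
  have hdδ : d < t + δ := hd.trans_le (min_le_right _ _)
  refine ⟨d, ?_, htd, hdc.le⟩
  refine hσ.extend ht.1 (hγ.mono (Icc_subset_Icc ht.1 hd1.le)) φ hφ hφs fun u hu => hsub ⟨?_, ?_⟩
  · rw [Metric.mem_ball, Real.dist_eq, abs_lt]
    constructor <;> linarith [hu.1, hu.2]
  · exact ⟨ht.1.trans hu.1, hu.2.trans hd1.le⟩

/-- A point is evenly covered by a separated local homeomorphism if it has a neighbourhood `U` with
a contraction to the point all of whose tracks lift, from either end. -/
theorem isEvenlyCovered_of_contraction {p : E → X} (hp : IsLocalHomeomorph p)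
    (sep : IsSeparatedMap p) {x : X} {U : Set X} (hU : IsOpen U) (hx : x ∈ U)
    (h : C(unitInterval × U, X)) (h1 : ∀ y, h (1, y) = y)
    (lift_zero : ∀ (y : U) (e : E), p e = x → ∃ Γ : C(unitInterval, E), Γ 0 = e ∧ ∀ t, p (Γ t) = h (t, y))
    (lift_one : ∀ (y : U) (z : E), p z = y →
      ∃ Γ : C(unitInterval, E), Γ 1 = z ∧ p (Γ 0) = x ∧ ∀ t, p (Γ t) = h (t, y)) :
    IsEvenlyCovered p x (p ⁻¹' {x}) := by
  have hdisc : DiscreteTopology (p ⁻¹' {x}) :=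
    (IsDiscrete.of_openPartialHomeomorph p subset_rfl fun e _ => by
      obtain ⟨φ, hφ, h⟩ := hp e
      exact ⟨φ, hφ, h.symm⟩).1
  choose Γ Γ0 Γl using fun (a : U × (p ⁻¹' {x})) => lift_zero a.1 a.2 a.2.2
  let f : C(unitInterval × (U × (p ⁻¹' {x})), X) := h.comp ⟨fun a => (a.1, a.2.1), by fun_prop⟩
  -- Lifts depend continuously on parameters when their starting points do; here these are the
  -- points of the fibre.
  have hcont : Continuous fun a : unitInterval × (U × (p ⁻¹' {x})) => Γ a.2 a.1 := by
    refine hp.continuous_lift sep f (by ext a; exact Γl a.2 a.1) ?_ fun a => (Γ a).continuous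
    simp_rw [Γ0]
    fun_prop
  -- The inverse trivialization: transport a fibre point along the track to `y`.
  let φ : U × (p ⁻¹' {x}) → E := fun a => Γ a 1
  have hφp : ∀ a, p (φ a) = a.1 := fun a => (Γl a 1).trans (h1 _)
  have hφc : Continuous φ := hcont.comp (Continuous.prodMk_right 1)
  -- Since the fibre is discrete, the projection to `U` is a local homeomorphism; cancelling `p`
  -- gives the same for `φ`.
  have hcomp : IsLocalHomeomorph (p ∘ φ) := by
    have e1 : p ∘ φ = Subtype.val ∘ Prod.fst := funext hφp
    rw [e1]
    refine hU.isOpenEmbedding_subtypeVal.isLocalHomeomorph.comp ?_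
    refine IsLocalHomeomorph.mk _ fun a => ?_
    let ψ : OpenPartialHomeomorph (U × (p ⁻¹' {x})) U :=
      { toFun := Prod.fst
        invFun := fun u => (u, a.2)
        source := univ ×ˢ {a.2}
        target := univ
        map_source' := fun _ _ => mem_univ _
        map_target' := fun _ _ => ⟨mem_univ _, rfl⟩
        left_inv' := fun _ hb => Prod.ext rfl hb.2.symm
        right_inv' := fun _ _ => rfl
        open_source := isOpen_univ.prod (isOpen_discrete _)
        open_target := isOpen_univ
        continuousOn_toFun := continuousOn_fst
        continuousOn_invFun := by fun_prop }
    exact ⟨ψ, ⟨mem_univ _, rfl⟩, fun _ _ => rfl⟩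
  have hφl : IsLocalHomeomorph φ := hcomp.of_comp hp hφc
  -- Lifts of one track that agree at time 1 agree at time 0, which recovers the fibre point.
  have hinj : Function.Injective φ := by
    rintro ⟨y, e⟩ ⟨y', e'⟩ hh
    have hy : y = y' := Subtype.ext (by rw [← hφp (y, e), hh, hφp])
    subst hy
    have := sep.eq_of_comp_eq hp.isLocallyInjective (Γ (y, e)).continuous (Γ (y, e')).continuous
      (by ext t; simp [Γl]) 1 hh
    have h0 := congrFun this 0
    rw [Γ0, Γ0] at h0
    exact Prod.ext rfl (Subtype.ext h0)
  have hrange : range φ = p ⁻¹' U := by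
    ext z
    constructor
    · rintro ⟨a, rfl⟩
      change p (φ a) ∈ U
      rw [hφp]
      exact a.1.2
    · intro hz
      obtain ⟨Λ, hΛ1, hΛ0, hΛ⟩ := lift_one ⟨p z, hz⟩ z rfl
      refine ⟨(⟨p z, hz⟩, ⟨Λ 0, hΛ0⟩), ?_⟩
      have := sep.eq_of_comp_eq hp.isLocallyInjective
        (Γ (⟨p z, hz⟩, ⟨Λ 0, hΛ0⟩)).continuous Λ.continuous
        (by ext t; simp [Γl, hΛ]) 0 (Γ0 _)
      exact (congrFun this 1).trans hΛ1
  have hemb : IsOpenEmbedding φ := hφl.isOpenEmbedding_of_injective hinj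
  let H : p ⁻¹' U ≃ₜ U × (p ⁻¹' {x}) :=
    ((hemb.toIsEmbedding.toHomeomorph).trans (Homeomorph.setCongr hrange)).symm
  refine ⟨hdisc, U, hx, hU, hU.preimage hp.continuous, H, fun z => ?_⟩
  have hz : φ (H z) = z := congrArg Subtype.val (H.symm_apply_apply z)
  rw [← hφp (H z), hz]

end Topological

/-! ### Lengths and distances of an explicitly given metric. -/

section MetricLength

open Set Filter MeasureTheory
open scoped ENNReal NNReal

variable {n : ℕ} {M : Type*} [TopologicalSpace M] [ChartedSpace (EuclideanSpace ℝ (Fin n)) M]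

/-- The norm of a tangent vector. -/
def speed (g : TangentMetric n M) (x : M) (v : TangentSpace (𝓡 n) x) : ℝ≥0∞ :=
  ENNReal.ofReal √(g.inner x v v)

/-- The length of a path between the times `a` and `b`. -/
def metricLength (g : TangentMetric n M) (γ : ℝ → M) (a b : ℝ) : ℝ≥0∞ :=
  ∫⁻ t in Ioo a b, speed g (γ t) (mfderiv 𝓘(ℝ, ℝ) (𝓡 n) γ t 1)

/-- The Riemannian distance. -/
def metricEDist (g : TangentMetric n M) (x y : M) : ℝ≥0∞ :=
  letI : Bundle.RiemannianBundle (fun x : M => TangentSpace (𝓡 n) x) := ⟨g⟩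
  Manifold.riemannianEDist (𝓡 n) x y

/-- The metric varies continuously with the base point. -/
def IsContinuousMetric [IsManifold (𝓡 n) 1 M] (g : TangentMetric n M) : Prop :=
  letI : Bundle.RiemannianBundle (fun x : M => TangentSpace (𝓡 n) x) := ⟨g⟩
  IsContinuousRiemannianBundle (EuclideanSpace ℝ (Fin n)) (fun x : M => TangentSpace (𝓡 n) x)

theorem enorm_eq_speed (g : TangentMetric n M) (x : M) (v : TangentSpace (𝓡 n) x) :
    letI : Bundle.RiemannianBundle (fun x : M => TangentSpace (𝓡 n) x) := ⟨g⟩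
    ‖v‖ₑ = speed g x v := by
  let : Bundle.RiemannianBundle (fun x : M => TangentSpace (𝓡 n) x) := ⟨g⟩
  change ‖v‖ₑ = speed g x v
  rw [← ofReal_norm, norm_eq_sqrt_real_inner]
  rfl

theorem pathELength_eq_metricLength (g : TangentMetric n M) (γ : ℝ → M) (a b : ℝ) :
    letI : Bundle.RiemannianBundle (fun x : M => TangentSpace (𝓡 n) x) := ⟨g⟩
    Manifold.pathELength (𝓡 n) γ a b = metricLength g γ a b := by
  let : Bundle.RiemannianBundle (fun x : M => TangentSpace (𝓡 n) x) := ⟨g⟩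
  change Manifold.pathELength (𝓡 n) γ a b = metricLength g γ a b
  rw [Manifold.pathELength_eq_lintegral_mfderiv_Ioo]
  exact lintegral_congr fun t => enorm_eq_speed g _ _

theorem metricEDist_self (g : TangentMetric n M) (x : M) : metricEDist g x x = 0 := by
  let : Bundle.RiemannianBundle (fun x : M => TangentSpace (𝓡 n) x) := ⟨g⟩
  exact Manifold.riemannianEDist_self

theorem metricEDist_comm (g : TangentMetric n M) (x y : M) :
    metricEDist g x y = metricEDist g y x := by
  let : Bundle.RiemannianBundle (fun x : M => TangentSpace (𝓡 n) x) := ⟨g⟩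
  exact Manifold.riemannianEDist_comm

theorem metricEDist_triangle (g : TangentMetric n M) (x y z : M) :
    metricEDist g x z ≤ metricEDist g x y + metricEDist g y z := by
  let : Bundle.RiemannianBundle (fun x : M => TangentSpace (𝓡 n) x) := ⟨g⟩
  exact Manifold.riemannianEDist_triangle

theorem metricEDist_le_metricLength (g : TangentMetric n M) {γ : ℝ → M} {a b : ℝ}
    (hγ : ContMDiffOn 𝓘(ℝ, ℝ) (𝓡 n) 1 γ (Icc a b)) (hab : a ≤ b) :
    metricEDist g (γ a) (γ b) ≤ metricLength g γ a b := by
  let : Bundle.RiemannianBundle (fun x : M => TangentSpace (𝓡 n) x) := ⟨g⟩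
  rw [← pathELength_eq_metricLength]
  exact Manifold.riemannianEDist_le_pathELength hγ rfl rfl hab

theorem exists_metricLength_lt (g : TangentMetric n M) {x y : M} {r : ℝ≥0∞}
    (h : metricEDist g x y < r) :
    ∃ γ : ℝ → M, γ 0 = x ∧ γ 1 = y ∧ ContMDiffOn 𝓘(ℝ, ℝ) (𝓡 n) 1 γ (Icc 0 1) ∧
      metricLength g γ 0 1 < r := by
  let : Bundle.RiemannianBundle (fun x : M => TangentSpace (𝓡 n) x) := ⟨g⟩
  simp_rw [← pathELength_eq_metricLength]
  exact Manifold.exists_lt_of_riemannianEDist_lt h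

theorem metricLength_mono (g : TangentMetric n M) (γ : ℝ → M) {a b c d : ℝ} (h : a ≤ c)
    (h' : d ≤ b) : metricLength g γ c d ≤ metricLength g γ a b :=
  lintegral_mono_set (Ioo_subset_Ioo h h')

theorem isCompleteMetric_iff (g : TangentMetric n M) : IsCompleteMetric g ↔ ∀ s : ℕ → M,
    (∀ ε : ℝ≥0∞, 0 < ε → ∃ N : ℕ, ∀ i ≥ N, ∀ j ≥ N, metricEDist g (s i) (s j) < ε) →
    ∃ x : M, Tendsto (fun i => metricEDist g (s i) x) atTop (𝓝 0) := Iff.rfl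

section Continuous

variable [IsManifold (𝓡 n) 1 M]

theorem IsContinuousMetric.eventually_lt {g : TangentMetric n M} (hg : IsContinuousMetric g) (x : M)
    {c : ℝ≥0∞} (hc : 0 < c) : ∀ᶠ y in 𝓝 x, metricEDist g x y < c := by
  let : Bundle.RiemannianBundle (fun x : M => TangentSpace (𝓡 n) x) := ⟨g⟩
  have : IsContinuousRiemannianBundle (EuclideanSpace ℝ (Fin n))
    (fun x : M => TangentSpace (𝓡 n) x) := hg
  exact eventually_riemannianEDist_lt (𝓡 n) x hc

theorem IsContinuousMetric.tendsto_metricEDist {g : TangentMetric n M} (hg : IsContinuousMetric g)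
    {ι : Type*} {l : Filter ι} {s : ι → M} {x : M} (h : Tendsto s l (𝓝 x)) :
    Tendsto (fun i => metricEDist g (s i) x) l (𝓝 0) := by
  rw [ENNReal.tendsto_nhds_zero]
  intro ε hε
  filter_upwards [h.eventually (hg.eventually_lt x hε)] with i hi
  rw [metricEDist_comm]
  exact hi.le

theorem IsContinuousMetric.exists_ball_subset [T2Space M] {g : TangentMetric n M}
    (hg : IsContinuousMetric g) {x : M} {s : Set M} (hs : s ∈ 𝓝 x) :
    ∃ c > 0, ∀ y, metricEDist g x y < c → y ∈ s := by
  let : Bundle.RiemannianBundle (fun x : M => TangentSpace (𝓡 n) x) := ⟨g⟩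
  have : IsContinuousRiemannianBundle (EuclideanSpace ℝ (Fin n))
    (fun x : M => TangentSpace (𝓡 n) x) := hg
  have : LocallyCompactSpace M := Manifold.locallyCompact_of_finiteDimensional (𝓡 n)
  obtain ⟨c, hc, h⟩ := setOfPred_riemannianEDist_lt_subset_nhds' (𝓡 n) hs
  exact ⟨c, hc, fun y hy => h hy⟩

theorem IsContinuousMetric.tendsto_nhds [T2Space M] {g : TangentMetric n M}
    (hg : IsContinuousMetric g) {ι : Type*} {l : Filter ι} {s : ι → M} {x : M}
    (h : Tendsto (fun i => metricEDist g (s i) x) l (𝓝 0)) : Tendsto s l (𝓝 x) := by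
  intro u hu
  obtain ⟨c, hc, hcu⟩ := hg.exists_ball_subset hu
  have : ∀ᶠ i in l, s i ∈ u := by
    filter_upwards [h.eventually (gt_mem_nhds hc)] with i hi
    exact hcu _ (by rwa [metricEDist_comm])
  exact this

/-- The derivative within `Icc 0 1` is continuous up to the end points, so compactness bounds its
norm. The unrestricted `mfderiv` is identified with it only at interior times. -/
theorem IsContinuousMetric.exists_speed_le {g : TangentMetric n M} (hg : IsContinuousMetric g)
    {γ : ℝ → M} (hγ : ContMDiffOn 𝓘(ℝ, ℝ) (𝓡 n) 1 γ (Icc 0 1)) :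
    ∃ C : ℝ≥0, ∀ t ∈ Ioo (0 : ℝ) 1, speed g (γ t) (mfderiv 𝓘(ℝ, ℝ) (𝓡 n) γ t 1) ≤ C := by
  let : Bundle.RiemannianBundle (fun x : M => TangentSpace (𝓡 n) x) := ⟨g⟩
  have : IsContinuousRiemannianBundle (EuclideanSpace ℝ (Fin n))
    (fun x : M => TangentSpace (𝓡 n) x) := hg
  have huniq : UniqueMDiffOn 𝓘(ℝ, ℝ) (Icc (0 : ℝ) 1) :=
    uniqueMDiffOn_iff_uniqueDiffOn.mpr (uniqueDiffOn_Icc zero_lt_one)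
  have h1 := hγ.continuousOn_tangentMapWithin le_rfl huniq
  have h2 : ContinuousOn (fun t : ℝ => (⟨t, 1⟩ : TangentBundle 𝓘(ℝ, ℝ) ℝ)) (Icc 0 1) :=
    ((contMDiff_vectorSpace_iff_contDiff (n := 1)).mpr contDiff_const).continuous.continuousOn
  have h3 : ContinuousOn (fun t : ℝ => (⟨γ t, mfderivWithin 𝓘(ℝ, ℝ) (𝓡 n) γ (Icc 0 1) t 1⟩ :
      TangentBundle (𝓡 n) M)) (Icc 0 1) := h1.comp h2 fun t ht => ht
  have h4 := h3.inner_bundle h3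
  obtain ⟨C, hC⟩ := isCompact_Icc.bddAbove_image h4
  refine ⟨Real.toNNReal √C, fun t ht => ?_⟩
  rw [← mfderivWithin_of_mem_nhds (Icc_mem_nhds ht.1 ht.2)]
  exact ENNReal.ofReal_le_ofReal (Real.sqrt_le_sqrt (hC (mem_image_of_mem _ (Ioo_subset_Icc_self ht))))

end Continuous

end MetricLength

/-! ### Local diffeomorphisms and the inverse function theorem. -/

section LocalDiffeo

open Set Filter

variable {n : ℕ} {M : Type*} [TopologicalSpace M] [ChartedSpace (EuclideanSpace ℝ (Fin n)) M]
  {S : Type*} [TopologicalSpace S] [ChartedSpace (EuclideanSpace ℝ (Fin n)) S]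

/-- A continuous lift of a `C^k` map through a local diffeomorphism is `C^k`. -/
theorem contMDiffWithinAt_of_comp_isLocalDiffeomorph {r : S → M}
    (hr : IsLocalDiffeomorph (𝓡 n) (𝓡 n) ∞ r)
    {E' : Type*} [NormedAddCommGroup E'] [NormedSpace ℝ E'] {H' : Type*} [TopologicalSpace H']
    {I' : ModelWithCorners ℝ E' H'} {P : Type*} [TopologicalSpace P] [ChartedSpace H' P]
    {f : P → S} {A : Set P} {x : P} {k : WithTop ℕ∞} (hk : k ≤ ∞)
    (hf : ContinuousWithinAt f A x) (hx : x ∈ A)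
    (hrf : ContMDiffWithinAt I' (𝓡 n) k (r ∘ f) A x) : ContMDiffWithinAt I' (𝓡 n) k f A x := by
  obtain ⟨Φ, hΦ, heq⟩ := hr (f x)
  have h1 : ContMDiffAt (𝓡 n) (𝓡 n) k Φ.symm (r (f x)) := by
    refine (Φ.contMDiffOn_invFun.contMDiffAt (Φ.open_target.mem_nhds ?_)).of_le hk
    rw [heq hΦ]
    exact Φ.map_source hΦ
  refine (h1.comp_contMDiffWithinAt x hrf).congr_of_eventuallyEq_of_mem ?_ hx
  filter_upwards [hf (Φ.open_source.mem_nhds hΦ)] with y hy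
  have hy' : f y ∈ Φ.source := hy
  change f y = Φ.toPartialEquiv.symm (r (f y))
  rw [heq hy']
  exact (Φ.left_inv hy').symm

theorem contMDiff_of_comp_isLocalDiffeomorph {r : S → M}
    (hr : IsLocalDiffeomorph (𝓡 n) (𝓡 n) ∞ r)
    {E' : Type*} [NormedAddCommGroup E'] [NormedSpace ℝ E'] {H' : Type*} [TopologicalSpace H']
    {I' : ModelWithCorners ℝ E' H'} {P : Type*} [TopologicalSpace P] [ChartedSpace H' P]
    {f : P → S} {k : WithTop ℕ∞} (hk : k ≤ ∞) (hf : Continuous f)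
    (hrf : ContMDiff I' (𝓡 n) k (r ∘ f)) : ContMDiff I' (𝓡 n) k f := fun x =>
  contMDiffWithinAt_of_comp_isLocalDiffeomorph hr hk hf.continuousAt.continuousWithinAt
    (mem_univ x) (hrf x)

/-- The inverse function theorem: a smooth map with injective differentials between manifolds of the
same dimension is a local diffeomorphism. -/
theorem isLocalDiffeomorph_of_injective_mfderiv [IsManifold (𝓡 n) ∞ M] [IsManifold (𝓡 n) ∞ S]
    {f : S → M} (hf : ContMDiff (𝓡 n) (𝓡 n) ∞ f)
    (hinj : ∀ s, Function.Injective (mfderiv (𝓡 n) (𝓡 n) f s)) :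
    IsLocalDiffeomorph (𝓡 n) (𝓡 n) ∞ f := by
  intro s
  set φ := chartAt (EuclideanSpace ℝ (Fin n)) s with hφ
  set ψ := chartAt (EuclideanSpace ℝ (Fin n)) (f s) with hψ
  have hsφ : s ∈ φ.source := mem_chart_source _ s
  have hsψ : f s ∈ ψ.source := mem_chart_source _ (f s)
  let F : EuclideanSpace ℝ (Fin n) → EuclideanSpace ℝ (Fin n) := ψ ∘ f ∘ φ.symm
  let D : Set (EuclideanSpace ℝ (Fin n)) := φ.target ∩ φ.symm ⁻¹' (f ⁻¹' ψ.source)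
  have hD : IsOpen D := φ.isOpen_inter_preimage_symm (ψ.open_source.preimage hf.continuous)
  have hsD : φ s ∈ D := ⟨φ.map_source hsφ, by simpa [φ.left_inv hsφ] using hsψ⟩
  have hFm : ContMDiffOn (𝓡 n) (𝓡 n) ∞ F D :=
    (contMDiffOn_chart (I := 𝓡 n)).comp (hf.comp_contMDiffOn
      ((contMDiffOn_chart_symm (I := 𝓡 n)).mono inter_subset_left)) fun x hx => hx.2
  have hF : ContDiffOn ℝ ∞ F D := contMDiffOn_iff_contDiffOn.mp hFm
  -- The manifold derivative is defined through the preferred charts at `s` and `f s`, which are `φ`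
  -- and `ψ`.
  have hmd : mfderiv (𝓡 n) (𝓡 n) f s = fderiv ℝ F (φ s) := by
    refine (hf.mdifferentiable (by simp) s).mfderiv.trans ?_
    simp only [mfld_simps, fderivWithin_univ]
    rfl
  -- Smoothness of the local inverse at a point needs an invertible derivative there. Restricting to
  -- the open set `V` secures this on the whole target, not only at the base point.
  let V : Set (EuclideanSpace ℝ (Fin n)) := D ∩ fderiv ℝ F ⁻¹' range
    ((↑) : (EuclideanSpace ℝ (Fin n) ≃L[ℝ] EuclideanSpace ℝ (Fin n)) →
      (EuclideanSpace ℝ (Fin n) →L[ℝ] EuclideanSpace ℝ (Fin n)))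
  have hV : IsOpen V := (hF.continuousOn_fderiv_of_isOpen hD (by simp)).isOpen_inter_preimage hD
    ContinuousLinearEquiv.isOpen
  have hsV : φ s ∈ V := by
    refine ⟨hsD, ?_⟩
    have hi : Function.Injective (fderiv ℝ F (φ s)) := by rw [← hmd]; exact hinj s
    refine ⟨(LinearEquiv.ofInjectiveEndo (fderiv ℝ F (φ s)).toLinearMap hi).toContinuousLinearEquiv,
      ?_⟩
    ext v
    rfl
  obtain ⟨A, hA⟩ := hsV.2
  have hFs : ContDiffAt ℝ ∞ F (φ s) := hF.contDiffAt (hD.mem_nhds hsD)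
  have hFA : HasFDerivAt F (A : _ →L[ℝ] _) (φ s) := by
    rw [hA]; exact (hFs.differentiableAt (by simp)).hasFDerivAt
  let e := (hFs.toOpenPartialHomeomorph F hFA (by simp)).restrOpen V hV
  have heF : ∀ x, e x = F x := fun x => rfl
  have hes : φ s ∈ e.source := ⟨hFs.mem_toOpenPartialHomeomorph_source hFA (by simp), hsV⟩
  have heV : ∀ x ∈ e.source, x ∈ V := fun x hx => hx.2
  have hesymm : ContDiffOn ℝ ∞ e.symm e.target := by
    intro y hy
    have hxV := heV _ (e.map_target hy)
    obtain ⟨B, hB⟩ := hxV.2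
    have hFx : ContDiffAt ℝ ∞ F (e.symm y) := hF.contDiffAt (hD.mem_nhds hxV.1)
    refine (e.contDiffAt_symm (f₀' := B) hy ?_ hFx).contDiffWithinAt
    rw [hB]
    exact (hFx.differentiableAt (by simp)).hasFDerivAt
  let Ψ := (φ.trans e).trans ψ.symm
  have hΨsrc : ∀ x ∈ Ψ.source, x ∈ φ.source ∧ φ x ∈ e.source ∧ f x ∈ ψ.source := by
    intro x hx
    have hx1 : x ∈ φ.source ∧ φ x ∈ e.source := by simpa using hx.1
    refine ⟨hx1.1, hx1.2, ?_⟩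
    have := (heV _ hx1.2).1.2
    simpa [φ.left_inv hx1.1] using this
  have hΨf : ∀ x ∈ Ψ.source, f x = Ψ x := by
    intro x hx
    obtain ⟨h1, h2, h3⟩ := hΨsrc x hx
    change f x = ψ.symm (ψ (f (φ.symm (φ x))))
    rw [φ.left_inv h1, ψ.left_inv h3]
  refine ⟨⟨Ψ.toPartialEquiv, Ψ.open_source, Ψ.open_target, ?_, ?_⟩, ?_, fun x hx => hΨf x hx⟩
  · exact hf.contMDiffOn.congr fun x hx => (hΨf x hx).symm
  · have h1 : ContMDiffOn (𝓡 n) (𝓡 n) ∞ ψ Ψ.target :=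
      (contMDiffOn_chart (I := 𝓡 n)).mono fun y hy => hy.1
    have h2 : ContMDiffOn (𝓡 n) (𝓡 n) ∞ (e.symm ∘ ψ) Ψ.target :=
      (contMDiffOn_iff_contDiffOn.mpr hesymm).comp h1 fun y hy => hy.2.1
    exact (contMDiffOn_chart_symm (I := 𝓡 n)).comp h2 fun y hy => hy.2.2
  · refine ⟨⟨hsφ, hes⟩, ?_⟩
    change F (φ s) ∈ ψ.target
    simp only [F, Function.comp_apply, φ.left_inv hsφ]
    exact ψ.map_source hsψ

end LocalDiffeo

/-! ### The induced form in terms of the two components. -/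

section Forms

open Set Filter

variable {n : ℕ} {M : Type*} [TopologicalSpace M] [ChartedSpace (EuclideanSpace ℝ (Fin n)) M]
  {S : Type*} [TopologicalSpace S] [ChartedSpace (EuclideanSpace ℝ (Fin n)) S]
  {P : Type*} [TopologicalSpace P] [ChartedSpace (EuclideanSpace ℝ (Fin n)) P]

/-- The pullback `f^* g` of a Riemannian metric under a map. -/
def pullTensor (g : TangentMetric n M) (f : S → M) (s : S) (v w : TangentSpace (𝓡 n) s) : ℝ :=
  g.inner (f s) (mfderiv (𝓡 n) (𝓡 n) f s v) (mfderiv (𝓡 n) (𝓡 n) f s w)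

/-- The differential of a real function. -/
def realDiff (τ : S → ℝ) (s : S) (v : TangentSpace (𝓡 n) s) : ℝ :=
  mfderiv (𝓡 n) 𝓘(ℝ, ℝ) τ s v

theorem pullTensor_comp (g : TangentMetric n M) {f : S → M} {r : P → S} {x : P}
    (hf : MDifferentiableAt (𝓡 n) (𝓡 n) f (r x)) (hr : MDifferentiableAt (𝓡 n) (𝓡 n) r x)
    (v w : TangentSpace (𝓡 n) x) :
    pullTensor g (f ∘ r) x v w =
      pullTensor g f (r x) (mfderiv (𝓡 n) (𝓡 n) r x v) (mfderiv (𝓡 n) (𝓡 n) r x w) := by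
  unfold pullTensor
  rw [mfderiv_comp x hf hr]
  rfl

theorem realDiff_comp {τ : S → ℝ} {r : P → S} {x : P}
    (hf : MDifferentiableAt (𝓡 n) 𝓘(ℝ, ℝ) τ (r x)) (hr : MDifferentiableAt (𝓡 n) (𝓡 n) r x)
    (v : TangentSpace (𝓡 n) x) :
    realDiff (τ ∘ r) x v = realDiff τ (r x) (mfderiv (𝓡 n) (𝓡 n) r x v) := by
  unfold realDiff
  rw [mfderiv_comp x hf hr]
  rfl

theorem inducedForm_apply (g : TangentMetric n M) {F : S → M × ℝ} {s : S}
    (hF : MDifferentiableAt (𝓡 n) ((𝓡 n).prod 𝓘(ℝ, ℝ)) F s) (v w : TangentSpace (𝓡 n) s) :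
    inducedForm g F s v w = pullTensor g (fun x => (F x).1) s v w
      - realDiff (fun x => (F x).2) s v * realDiff (fun x => (F x).2) s w := by
  have h1 : mfderiv (𝓡 n) (𝓡 n) (fun x => (F x).1) s =
      (mfderiv ((𝓡 n).prod 𝓘(ℝ, ℝ)) (𝓡 n) (Prod.fst : M × ℝ → M) (F s)).comp
        (mfderiv (𝓡 n) ((𝓡 n).prod 𝓘(ℝ, ℝ)) F s) := mfderiv_comp s mdifferentiableAt_fst hF
  have h2 : mfderiv (𝓡 n) 𝓘(ℝ, ℝ) (fun x => (F x).2) s =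
      (mfderiv ((𝓡 n).prod 𝓘(ℝ, ℝ)) 𝓘(ℝ, ℝ) (Prod.snd : M × ℝ → ℝ) (F s)).comp
        (mfderiv (𝓡 n) ((𝓡 n).prod 𝓘(ℝ, ℝ)) F s) := mfderiv_comp s mdifferentiableAt_snd hF
  unfold pullTensor realDiff
  rw [h1, h2]
  rfl

theorem inducedForm_eq_zero_of_mfderiv_eq_zero (g : TangentMetric n M) {F : S → M × ℝ} {s : S}
    {v : TangentSpace (𝓡 n) s} (hv : mfderiv (𝓡 n) ((𝓡 n).prod 𝓘(ℝ, ℝ)) F s v = 0) :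
    inducedForm g F s v v = 0 := by
  change lorentzMetric g (F s) (mfderiv (𝓡 n) ((𝓡 n).prod 𝓘(ℝ, ℝ)) F s v) _ = 0
  rw [hv, map_zero]
  rfl

namespace IsSpacelikeImmersion

variable {g : TangentMetric n M} {F : S → M × ℝ} (hF : IsSpacelikeImmersion g F)
include hF

theorem contMDiff_fst : ContMDiff (𝓡 n) (𝓡 n) ∞ (fun s => (F s).1) :=
  _root_.contMDiff_fst.comp hF.smooth

theorem contMDiff_snd : ContMDiff (𝓡 n) 𝓘(ℝ, ℝ) ∞ (fun s => (F s).2) :=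
  _root_.contMDiff_snd.comp hF.smooth

theorem inducedMetric_apply (s : S) (v w : TangentSpace (𝓡 n) s) :
    hF.inducedMetric.inner s v w = pullTensor g (fun x => (F x).1) s v w
      - realDiff (fun x => (F x).2) s v * realDiff (fun x => (F x).2) s w :=
  inducedForm_apply g (hF.smooth.mdifferentiable (by simp) s) v w

theorem inducedMetric_le (s : S) (v : TangentSpace (𝓡 n) s) :
    hF.inducedMetric.inner s v v ≤ pullTensor g (fun x => (F x).1) s v v := by
  rw [hF.inducedMetric_apply]
  nlinarith [mul_self_nonneg (realDiff (fun x => (F x).2) s v)]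

/-- This is nonnegativity of the induced metric, rearranged. It bounds the variation of the height
by the length of the projected path. -/
theorem sq_realDiff_le (s : S) (v : TangentSpace (𝓡 n) s) :
    realDiff (fun x => (F x).2) s v ^ 2 ≤ pullTensor g (fun x => (F x).1) s v v := by
  by_cases hv : v = 0
  · subst hv
    simp only [realDiff, pullTensor, map_zero]
    exact (zero_pow two_ne_zero).le
  · have := hF.inducedMetric.pos s v hv
    rw [hF.inducedMetric_apply] at this
    nlinarith

/-- On a kernel vector of the projected differential the induced metric would be at most zero. -/
theorem injective_mfderiv_fst (s : S) :
    Function.Injective (mfderiv (𝓡 n) (𝓡 n) (fun x => (F x).1) s) := by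
  rw [injective_iff_map_eq_zero]
  intro v hv
  by_contra h
  have h1 := (hF.inducedMetric.pos s v h).trans_le (hF.inducedMetric_le s v)
  simp [pullTensor, hv] at h1

theorem isLocalDiffeomorph_fst [IsManifold (𝓡 n) ∞ M] [IsManifold (𝓡 n) ∞ S] :
    IsLocalDiffeomorph (𝓡 n) (𝓡 n) ∞ (fun s => (F s).1) :=
  isLocalDiffeomorph_of_injective_mfderiv hF.contMDiff_fst hF.injective_mfderiv_fst

end IsSpacelikeImmersion

/-- A metric is continuous if its values on all the vector fields with constant coordinates in the
canonical trivializations are continuous. -/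
theorem isContinuousMetric_of_forall [IsManifold (𝓡 n) 1 M] (g : TangentMetric n M)
    (h : ∀ (x : M) (v w : EuclideanSpace ℝ (Fin n)), ContinuousAt (fun y => g.inner y
      ((trivializationAt (EuclideanSpace ℝ (Fin n)) (TangentSpace (𝓡 n)) x).symm y v)
      ((trivializationAt (EuclideanSpace ℝ (Fin n)) (TangentSpace (𝓡 n)) x).symm y w)) x) :
    IsContinuousMetric g := by
  let : Bundle.RiemannianBundle (fun x : M => TangentSpace (𝓡 n) x) := ⟨g⟩
  refine ⟨g.inner, ?_, fun _ _ _ => rfl⟩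
  rw [continuous_iff_continuousAt]
  intro x
  -- In a trivialization the metric is a map into bilinear forms on a finite-dimensional space,
  -- whose continuity may be tested on fixed vectors.
  rw [continuousAt_hom_bundle]
  refine ⟨continuousAt_id, ?_⟩
  rw [continuousAt_clm_apply]
  intro v
  rw [continuousAt_clm_apply]
  intro w
  refine (h x v w).congr ?_
  have hb : (trivializationAt (EuclideanSpace ℝ (Fin n)) (TangentSpace (𝓡 n)) x).baseSet ∈ 𝓝 x :=
    (Bundle.Trivialization.open_baseSet _).mem_nhds (FiberBundle.mem_baseSet_trivializationAt' x)
  filter_upwards [hb] with y hy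
  rw [inCoordinates_apply_eq₂ hy hy (Set.mem_univ _)]
  simp

theorem continuousAt_trivializationAt_symm [IsManifold (𝓡 n) 1 M] (x : M)
    (v : EuclideanSpace ℝ (Fin n)) : ContinuousAt (fun y => (⟨y,
      (trivializationAt (EuclideanSpace ℝ (Fin n)) (TangentSpace (𝓡 n)) x).symm y v⟩ :
      TangentBundle (𝓡 n) M)) x := by
  set e := trivializationAt (EuclideanSpace ℝ (Fin n)) (TangentSpace (𝓡 n)) x with he
  have hx : x ∈ e.baseSet := FiberBundle.mem_baseSet_trivializationAt' x
  have h1 : ContinuousAt (fun y => e.toOpenPartialHomeomorph.symm (y, v)) x := by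
    refine ContinuousAt.comp (f := fun y => (y, v)) (e.continuousAt_symm ?_) (by fun_prop)
    rw [e.target_eq]
    exact ⟨hx, mem_univ _⟩
  refine h1.congr ?_
  filter_upwards [e.open_baseSet.mem_nhds hx] with y hy
  exact (e.mk_symm hy v).symm

/-- The tangent maps of both components are continuous, and so are the constant-coordinate fields
fed to them. Continuity is what ties the Riemannian distance to the topology of the hypersurface. -/
theorem IsSpacelikeImmersion.isContinuousMetric [IsManifold (𝓡 n) ∞ M] [IsManifold (𝓡 n) ∞ S]
    {g : TangentMetric n M} (hg : IsContinuousMetric g) {F : S → M × ℝ}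
    (hF : IsSpacelikeImmersion g F) : IsContinuousMetric hF.inducedMetric := by
  refine isContinuousMetric_of_forall _ fun x v w => ?_
  simp_rw [hF.inducedMetric_apply]
  let : Bundle.RiemannianBundle (fun x : M => TangentSpace (𝓡 n) x) := ⟨g⟩
  have : IsContinuousRiemannianBundle (EuclideanSpace ℝ (Fin n))
    (fun x : M => TangentSpace (𝓡 n) x) := hg
  have h1 : ∀ v, ContinuousAt (fun y => (⟨(F y).1, mfderiv (𝓡 n) (𝓡 n) (fun x => (F x).1) y
      ((trivializationAt (EuclideanSpace ℝ (Fin n)) (TangentSpace (𝓡 n)) x).symm y v)⟩ :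
      TangentBundle (𝓡 n) M)) x := fun v =>
    ((hF.contMDiff_fst.continuous_tangentMap (by simp)).continuousAt).comp
      (continuousAt_trivializationAt_symm x v)
  have h2 : ∀ v, ContinuousAt (fun y => realDiff (fun x => (F x).2) y
      ((trivializationAt (EuclideanSpace ℝ (Fin n)) (TangentSpace (𝓡 n)) x).symm y v)) x := by
    intro v
    have := ((hF.contMDiff_snd.continuous_tangentMap (by simp)).continuousAt).comp
      (continuousAt_trivializationAt_symm x v)
    have h3 := (contMDiff_snd_tangentBundle_modelSpace ℝ 𝓘(ℝ, ℝ) (n := 0)).continuous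
    exact h3.continuousAt.comp this
  exact ((h1 v).inner_bundle (h1 w)).sub ((h2 v).mul (h2 w))

end Forms

/-! ### Comparison of lengths, and lifting of C¹ paths. -/

section PathLifting

open Set Filter MeasureTheory
open scoped ENNReal NNReal

variable {n : ℕ} {M : Type*} [TopologicalSpace M] [ChartedSpace (EuclideanSpace ℝ (Fin n)) M]
  {S : Type*} [TopologicalSpace S] [ChartedSpace (EuclideanSpace ℝ (Fin n)) S]

theorem speed_comp (g : TangentMetric n M) {r : S → M} {σ : ℝ → S} {t : ℝ}
    (hr : MDifferentiableAt (𝓡 n) (𝓡 n) r (σ t)) (hσ : MDifferentiableAt 𝓘(ℝ, ℝ) (𝓡 n) σ t) :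
    speed g ((r ∘ σ) t) (mfderiv 𝓘(ℝ, ℝ) (𝓡 n) (r ∘ σ) t 1) = ENNReal.ofReal
      √(pullTensor g r (σ t) (mfderiv 𝓘(ℝ, ℝ) (𝓡 n) σ t 1) (mfderiv 𝓘(ℝ, ℝ) (𝓡 n) σ t 1)) := by
  unfold speed pullTensor
  rw [mfderiv_comp t hr hσ]
  rfl

theorem speed_congr (g : TangentMetric n M) {γ γ' : ℝ → M} {t : ℝ} (h : γ =ᶠ[𝓝 t] γ') :
    speed g (γ t) (mfderiv 𝓘(ℝ, ℝ) (𝓡 n) γ t 1) =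
      speed g (γ' t) (mfderiv 𝓘(ℝ, ℝ) (𝓡 n) γ' t 1) := by
  unfold speed
  rw [h.mfderiv_eq]
  -- The two velocities lie in tangent spaces over different terms, so the vector is read in the
  -- common model space before the base points are identified.
  have : ∀ x y : M, x = y → ∀ v : EuclideanSpace ℝ (Fin n),
      g.inner x (v : TangentSpace (𝓡 n) x) (v : TangentSpace (𝓡 n) x) =
      g.inner y (v : TangentSpace (𝓡 n) y) (v : TangentSpace (𝓡 n) y) := by
    rintro x _ rfl v
    rfl
  exact congrArg (fun a => ENNReal.ofReal √a) (this _ _ h.eq_of_nhds _)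

theorem metricLength_congr (g : TangentMetric n M) {γ γ' : ℝ → M} {a b : ℝ}
    (h : EqOn γ γ' (Ioo a b)) : metricLength g γ a b = metricLength g γ' a b :=
  setLIntegral_congr_fun measurableSet_Ioo fun _ ht =>
    speed_congr g (h.eventuallyEq_of_mem (Ioo_mem_nhds ht.1 ht.2))

theorem mdifferentiableAt_of_contMDiffOn_Icc {σ : ℝ → S} {a b t : ℝ}
    (hσ : ContMDiffOn 𝓘(ℝ, ℝ) (𝓡 n) 1 σ (Icc a b)) (ht : t ∈ Ioo a b) :
    MDifferentiableAt 𝓘(ℝ, ℝ) (𝓡 n) σ t :=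
  (hσ.contMDiffAt (Icc_mem_nhds ht.1 ht.2)).mdifferentiableAt one_ne_zero

theorem metricLength_le_metricLength_comp {g : TangentMetric n M} {h : TangentMetric n S} {r : S → M}
    (hr : MDifferentiable (𝓡 n) (𝓡 n) r) (hle : ∀ s v, h.inner s v v ≤ pullTensor g r s v v)
    {σ : ℝ → S} {a b : ℝ} (hσ : ContMDiffOn 𝓘(ℝ, ℝ) (𝓡 n) 1 σ (Icc a b)) :
    metricLength h σ a b ≤ metricLength g (r ∘ σ) a b := by
  refine setLIntegral_mono' measurableSet_Ioo fun t ht => ?_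
  rw [speed_comp g (hr _) (mdifferentiableAt_of_contMDiffOn_Icc hσ ht)]
  exact ENNReal.ofReal_le_ofReal (Real.sqrt_le_sqrt (hle _ _))

theorem metricLength_comp_le_metricLength {g : TangentMetric n M} {h : TangentMetric n S} {r : S → M}
    (hr : MDifferentiable (𝓡 n) (𝓡 n) r) (hle : ∀ s v, pullTensor g r s v v ≤ h.inner s v v)
    {σ : ℝ → S} {a b : ℝ} (hσ : ContMDiffOn 𝓘(ℝ, ℝ) (𝓡 n) 1 σ (Icc a b)) :
    metricLength g (r ∘ σ) a b ≤ metricLength h σ a b := by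
  refine setLIntegral_mono' measurableSet_Ioo fun t ht => ?_
  rw [speed_comp g (hr _) (mdifferentiableAt_of_contMDiffOn_Icc hσ ht)]
  exact ENNReal.ofReal_le_ofReal (Real.sqrt_le_sqrt (hle _ _))

theorem metricEDist_map_le {g : TangentMetric n M} {h : TangentMetric n S} {r : S → M}
    (hr : ContMDiff (𝓡 n) (𝓡 n) ∞ r) (hle : ∀ s v, pullTensor g r s v v ≤ h.inner s v v) (x y : S) :
    metricEDist g (r x) (r y) ≤ metricEDist h x y := by
  refine le_of_forall_gt fun c hc => ?_
  obtain ⟨σ, rfl, rfl, hσ, hl⟩ := exists_metricLength_lt h hc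
  refine lt_of_le_of_lt ?_ hl
  refine (metricEDist_le_metricLength g (γ := r ∘ σ)
    ((hr.of_le (by simp)).comp_contMDiffOn hσ) zero_le_one).trans ?_
  exact metricLength_comp_le_metricLength (hr.mdifferentiable (by simp)) hle hσ

/-- Continuous lifts of `C¹` paths through local diffeomorphisms are `C¹`. -/
theorem IsPathLiftOn.contMDiffOn {r : S → M} (hr : IsLocalDiffeomorph (𝓡 n) (𝓡 n) ∞ r)
    {γ : ℝ → M} {e : S} {A : Set ℝ} {σ : ℝ → S} (h : IsPathLiftOn r γ e A σ)
    (hγ : ContMDiffOn 𝓘(ℝ, ℝ) (𝓡 n) 1 γ A) : ContMDiffOn 𝓘(ℝ, ℝ) (𝓡 n) 1 σ A := fun t ht =>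
  contMDiffWithinAt_of_comp_isLocalDiffeomorph hr (by simp) (h.continuousOn t ht) ht
    ((hγ t ht).congr (fun u hu => h.lifts u hu) (h.lifts t ht))

/-- If `h ≤ r^* g`, then the lifts of `C¹` paths along `r` are no longer than the paths. -/
theorem IsPathLiftOn.metricLength_le {g : TangentMetric n M} {h : TangentMetric n S} {r : S → M}
    (hr : IsLocalDiffeomorph (𝓡 n) (𝓡 n) ∞ r)
    (hle : ∀ s v, h.inner s v v ≤ pullTensor g r s v v)
    {γ : ℝ → M} {e : S} {A : Set ℝ} {σ : ℝ → S} (hσ : IsPathLiftOn r γ e A σ)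
    (hγ : ContMDiffOn 𝓘(ℝ, ℝ) (𝓡 n) 1 γ A) {a b : ℝ} (hab : Icc a b ⊆ A) :
    metricLength h σ a b ≤ metricLength g γ a b := by
  rw [← metricLength_congr g (γ := r ∘ σ)
    fun t ht => hσ.lifts t (hab (Ioo_subset_Icc_self ht))]
  exact metricLength_le_metricLength_comp (hr.contMDiff.mdifferentiable (by simp)) hle
    ((hσ.contMDiffOn hr hγ).mono hab)

/-- The `C¹` paths lift along the map `r`, from every starting point. -/
def LiftsSmoothPaths (n : ℕ) {M : Type*} [TopologicalSpace M]
    [ChartedSpace (EuclideanSpace ℝ (Fin n)) M] {S : Type*} [TopologicalSpace S] (r : S → M) :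
    Prop :=
  ∀ γ : ℝ → M, ContMDiffOn 𝓘(ℝ, ℝ) (𝓡 n) 1 γ (Icc 0 1) → ∀ e, r e = γ 0 →
    ∃ σ, IsPathLiftOn r γ e (Icc 0 1) σ

theorem _root_.IsCoveringMap.liftsSmoothPaths {E : Type*} [TopologicalSpace E] {r : E → M}
    (hr : IsCoveringMap r) :
    LiftsSmoothPaths n r := by
  intro γ hγ e he
  obtain ⟨Γ, hΓ, hΓ0⟩ := hr.exists_path_lifts
    ⟨fun t : unitInterval => γ t, hγ.continuousOn.comp_continuous (by fun_prop) fun t => t.2⟩ e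
    (by simp [he])
  refine ⟨fun t => Γ (projIcc 0 1 zero_le_one t),
    (Γ.continuous.comp continuous_projIcc).continuousOn, fun t ht => ?_, by simpa using hΓ0⟩
  rw [projIcc_of_mem _ ht]
  exact congrFun hΓ ⟨t, ht⟩

/-- Along a local diffeomorphism from a complete manifold with `h ≤ r^* g`, the `C¹` paths lift. -/
theorem liftsSmoothPaths_of_isCompleteMetric [IsManifold (𝓡 n) ∞ M] [T2Space M]
    [IsManifold (𝓡 n) ∞ S] [T2Space S] {g : TangentMetric n M} {h : TangentMetric n S} {r : S → M}
    (hr : IsLocalDiffeomorph (𝓡 n) (𝓡 n) ∞ r)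
    (hle : ∀ s v, h.inner s v v ≤ pullTensor g r s v v) (hg : IsContinuousMetric g)
    (hh : IsContinuousMetric h) (hcomp : IsCompleteMetric h) : LiftsSmoothPaths n r := by
  intro γ hγ e he
  obtain ⟨C, hC⟩ := hg.exists_speed_le hγ
  refine exists_isPathLiftOn_of_mapClusterPt hr.isLocalHomeomorph hγ.continuousOn he
    fun b hb σ hσ => ?_
  have hsub : Ico 0 b ⊆ Icc (0 : ℝ) 1 := fun t ht => ⟨ht.1, ht.2.le.trans hb.2⟩
  -- The lift is `C`-Lipschitz, being no longer than `γ`; hence it is Cauchy along any sequence of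
  -- times increasing to `b`.
  have hdist : ∀ s t, 0 ≤ s → s ≤ t → t < b →
      metricEDist h (σ s) (σ t) ≤ C * ENNReal.ofReal (t - s) := by
    intro s t hs hst ht
    have hst' : Icc s t ⊆ Ico 0 b := fun u hu => ⟨hs.trans hu.1, hu.2.trans_lt ht⟩
    refine (metricEDist_le_metricLength h
      (((hσ.contMDiffOn hr (hγ.mono hsub))).mono hst') hst).trans ?_
    refine (hσ.metricLength_le hr hle (hγ.mono hsub) hst').trans ?_
    calc metricLength g γ s t ≤ ∫⁻ _ in Ioo s t, (C : ℝ≥0∞) := by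
          refine setLIntegral_mono' measurableSet_Ioo fun u hu => hC u ⟨hs.trans_lt hu.1, ?_⟩
          exact hu.2.trans (ht.trans_le hb.2)
      _ = C * ENNReal.ofReal (t - s) := by simp
  obtain ⟨u, hu, hub, hulim⟩ := exists_seq_strictMono_tendsto' hb.1
  have hsmall : Tendsto (fun k => (C : ℝ≥0∞) * ENNReal.ofReal (b - u k)) atTop (𝓝 0) := by
    have h1 : Tendsto (fun k => ENNReal.ofReal (b - u k)) atTop (𝓝 0) := by
      have := ENNReal.tendsto_ofReal ((tendsto_const_nhds (x := b)).sub hulim)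
      simpa using this
    have := ENNReal.Tendsto.const_mul h1 (Or.inr (ENNReal.coe_ne_top (r := C)))
    simpa using this
  obtain ⟨x, hx⟩ := (isCompleteMetric_iff h).mp hcomp (fun k => σ (u k)) (by
    intro ε hε
    obtain ⟨N, hN⟩ := (hsmall.eventually (gt_mem_nhds hε)).exists
    have key : ∀ i j, N ≤ i → i ≤ j → metricEDist h (σ (u i)) (σ (u j)) < ε := by
      intro i j hi hij
      refine (hdist _ _ (hub i).1.le (hu.monotone hij) (hub j).2).trans_lt (lt_of_le_of_lt ?_ hN)
      gcongr
      · exact (hub j).2.le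
      · exact hu.monotone hi
    refine ⟨N, fun i hi j hj => ?_⟩
    rcases le_total i j with hij | hij
    · exact key i j hi hij
    · rw [metricEDist_comm]
      exact key j i hj hij)
  have hx' : Tendsto (σ ∘ u) atTop (𝓝 x) := hh.tendsto_nhds hx
  have hu' : Tendsto u atTop (𝓝[<] b) :=
    tendsto_nhdsWithin_iff.mpr ⟨hulim, Eventually.of_forall fun k => (hub k).2⟩
  exact ⟨x, MapClusterPt.of_comp hu' hx'.mapClusterPt⟩

/-- For a proper spacelike immersion, the `C¹` paths lift along the first component. -/
theorem IsSpacelikeImmersion.liftsSmoothPaths [IsManifold (𝓡 n) ∞ M] [T2Space M]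
    [IsManifold (𝓡 n) ∞ S] [T2Space S] {g : TangentMetric n M} (hg : IsContinuousMetric g)
    {F : S → M × ℝ} (hF : IsSpacelikeImmersion g F) (hprop : IsProperMap F) :
    LiftsSmoothPaths n (fun s => (F s).1) := by
  intro γ hγ e he
  have hr := hF.isLocalDiffeomorph_fst
  obtain ⟨C, hC⟩ := hg.exists_speed_le hγ
  refine exists_isPathLiftOn_of_mapClusterPt hr.isLocalHomeomorph hγ.continuousOn he
    fun b hb σ hσ => ?_
  have hsub : Ico 0 b ⊆ Icc (0 : ℝ) 1 := fun t ht => ⟨ht.1, ht.2.le.trans hb.2⟩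
  have hσ1 := hσ.contMDiffOn hr (hγ.mono hsub)
  -- Mean value theorem: the derivative of the height is at most the speed of `γ`, hence at most
  -- `C`, and the elapsed time is at most 1.
  have hbound : ∀ t ∈ Ico 0 b, |(F (σ t)).2 - (F e).2| ≤ C := by
    intro t ht
    rcases ht.1.eq_or_lt with rfl | ht0
    · simp [hσ.zero]
    have hsm : ∀ c ∈ Ioo 0 t, MDifferentiableAt 𝓘(ℝ, ℝ) (𝓡 n) σ c := fun c hc =>
      (hσ1.contMDiffAt (Ico_mem_nhds hc.1 (hc.2.trans ht.2))).mdifferentiableAt one_ne_zero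
    have hd : ∀ c ∈ Ioo 0 t, HasDerivAt (fun t => (F (σ t)).2)
        (realDiff (fun x => (F x).2) (σ c) (mfderiv 𝓘(ℝ, ℝ) (𝓡 n) σ c 1)) c := by
      intro c hc
      have h1 := HasMFDerivAt.comp (g := fun x => (F x).2) (f := σ) c
        (hF.contMDiff_snd.mdifferentiable (by simp) (σ c)).hasMFDerivAt (hsm c hc).hasMFDerivAt
      have h2 : HasFDerivAt (fun t => (F (σ t)).2) ((show ℝ →L[ℝ] ℝ from
          (mfderiv (𝓡 n) 𝓘(ℝ, ℝ) (fun x => (F x).2) (σ c)).comp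
            (mfderiv 𝓘(ℝ, ℝ) (𝓡 n) σ c))) c := hasMFDerivAt_iff_hasFDerivAt.mp h1
      exact h2.hasDerivAt
    obtain ⟨c, hc, hc'⟩ := exists_hasDerivAt_eq_slope (fun t => (F (σ t)).2) _ ht0
      ((hF.contMDiff_snd.continuous.comp_continuousOn hσ.continuousOn).mono
        fun u hu => ⟨hu.1, hu.2.trans_lt ht.2⟩) hd
    have hc1 : c ∈ Ioo (0 : ℝ) 1 := ⟨hc.1, hc.2.trans (ht.2.trans_le hb.2)⟩
    have hev : γ =ᶠ[𝓝 c] (fun s => (F s).1) ∘ σ := by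
      filter_upwards [Ico_mem_nhds hc.1 (hc.2.trans ht.2)] with u hu using (hσ.lifts u hu).symm
    have hsp := hC c hc1
    rw [speed_congr g hev, speed_comp g (hr.contMDiff.mdifferentiable (by simp) _) (hsm c hc),
      ENNReal.ofReal_le_coe] at hsp
    have h2 := hF.sq_realDiff_le (σ c) (mfderiv 𝓘(ℝ, ℝ) (𝓡 n) σ c 1)
    have h3 := (Real.abs_le_sqrt h2).trans hsp
    rw [hc', hσ.zero, abs_div, div_le_iff₀ (by simpa using ht0.ne')] at h3
    refine h3.trans ?_
    have : |t - 0| ≤ 1 := by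
      rw [sub_zero, abs_of_pos ht0]
      exact ht.2.le.trans hb.2
    exact mul_le_of_le_one_right C.2 this
  -- The image of the lift under `F` lies in the compact product of the trace of `γ` and an interval
  -- of heights; properness pulls this back to a compact set.
  have hK : IsCompact (F ⁻¹' ((γ '' Icc 0 1) ×ˢ Metric.closedBall (F e).2 C)) :=
    hprop.isCompact_preimage
      ((isCompact_Icc.image_of_continuousOn hγ.continuousOn).prod (isCompact_closedBall _ _))
  obtain ⟨y, -, hy⟩ := hK.exists_clusterPt (f := map σ (𝓝[<] b)) (by
    rw [le_principal_iff, mem_map]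
    filter_upwards [Ico_mem_nhdsLT hb.1] with t ht
    refine ⟨⟨t, hsub ht, (hσ.lifts t ht).symm⟩, ?_⟩
    rw [Metric.mem_closedBall, Real.dist_eq]
    exact hbound t ht)
  exact ⟨y, hy⟩

end PathLifting

/-! ### From path lifting to coverings, and transfer of completeness. -/

section Covering

open Set Filter MeasureTheory
open scoped ENNReal NNReal

variable {n : ℕ} {M : Type*} [TopologicalSpace M] [ChartedSpace (EuclideanSpace ℝ (Fin n)) M]

/-- A local homeomorphism along which the `C¹` paths lift is a covering map. -/
theorem LiftsSmoothPaths.isCoveringMap [IsManifold (𝓡 n) ∞ M] {E : Type*} [TopologicalSpace E]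
    [T2Space E] {p : E → M} (hl : LiftsSmoothPaths n p) (hp : IsLocalHomeomorph p) :
    IsCoveringMap p := by
  intro x
  set φ := chartAt (EuclideanSpace ℝ (Fin n)) x
  have hx : x ∈ φ.source := mem_chart_source _ x
  obtain ⟨ε, hε, hball⟩ := Metric.isOpen_iff.mp φ.open_target (φ x) (φ.map_source hx)
  let U : Set M := φ.source ∩ φ ⁻¹' Metric.ball (φ x) ε
  have hU : IsOpen U := φ.isOpen_inter_preimage Metric.isOpen_ball
  have hxU : x ∈ U := ⟨hx, Metric.mem_ball_self hε⟩
  -- The radial segment from the centre of the coordinate ball; its tracks are smooth, so the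
  -- lifting hypothesis applies to them.
  let c : ℝ → U → EuclideanSpace ℝ (Fin n) := fun t y => φ x + t • (φ y - φ x)
  have hc : ∀ t ∈ Icc (0 : ℝ) 1, ∀ y, c t y ∈ φ.target := by
    intro t ht y
    refine hball (Metric.mem_ball.mpr ?_)
    have h1 : ‖φ y - φ x‖ < ε := by rw [← dist_eq_norm]; exact y.2.2
    simp only [c, dist_eq_norm, add_sub_cancel_left, norm_smul, Real.norm_eq_abs]
    rw [abs_of_nonneg ht.1]
    exact (mul_le_of_le_one_left (norm_nonneg _) ht.2).trans_lt h1
  have hφU : Continuous fun y : U => φ y :=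
    φ.continuousOn.comp_continuous continuous_subtype_val fun y => y.2.1
  let h : C(unitInterval × U, M) := ⟨fun a => φ.symm (c a.1 a.2), by
    refine φ.continuousOn_symm.comp_continuous ?_ fun a => hc a.1 a.1.2 a.2
    have := hφU.comp (continuous_snd (X := unitInterval) (Y := U))
    exact continuous_const.add
      ((continuous_subtype_val.comp continuous_fst).smul (this.sub continuous_const))⟩
  have hsm : ∀ y : U, ContMDiffOn 𝓘(ℝ, ℝ) (𝓡 n) 1 (fun t => φ.symm (c t y)) (Icc 0 1) := by
    intro y
    refine ((contMDiffOn_chart_symm (I := 𝓡 n) (n := ∞)).of_le (by simp)).comp (t := φ.target) ?_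
      fun t ht => hc t ht y
    refine ContMDiff.contMDiffOn (contMDiff_iff_contDiff.mpr ?_)
    simp only [c]
    fun_prop
  have h0 : ∀ y, φ.symm (c 0 y) = x := fun y => by simp [c, φ.left_inv hx]
  have h1 : ∀ y : U, φ.symm (c 1 y) = y := fun y => by simp [c, φ.left_inv y.2.1]
  refine isEvenlyCovered_of_contraction hp (T2Space.isSeparatedMap p) hU hxU h (fun y => h1 y)
    (fun y e he => ?_) fun y z hz => ?_
  · obtain ⟨σ, hσ⟩ := hl _ (hsm y) e (by rw [he, h0])
    exact ⟨⟨fun t => σ t, hσ.continuousOn.comp_continuous (by fun_prop) fun t => t.2⟩,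
      by simpa using hσ.zero, fun t => hσ.lifts t t.2⟩
  -- To prescribe the end of the lift instead of its start, lift the reversed segment and reverse
  -- again.
  · have hrev : ContMDiffOn 𝓘(ℝ, ℝ) (𝓡 n) 1 ((fun t => φ.symm (c t y)) ∘ fun t : ℝ => 1 - t)
        (Icc 0 1) := by
      refine (hsm y).comp (ContMDiff.contMDiffOn (contMDiff_iff_contDiff.mpr (by fun_prop))) ?_
      intro t ht
      exact ⟨by linarith [ht.2], by linarith [ht.1]⟩
    obtain ⟨σ, hσ⟩ := hl _ hrev z (by simp [hz, h1])
    refine ⟨⟨fun t => σ (1 - t), hσ.continuousOn.comp_continuous (by fun_prop) fun t =>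
      ⟨by linarith [t.2.2], by linarith [t.2.1]⟩⟩, by simpa using hσ.zero, ?_, fun t => ?_⟩
    · have := hσ.lifts 1 (by simp)
      simpa [h0] using this
    · have := hσ.lifts (1 - t) ⟨by linarith [t.2.2], by linarith [t.2.1]⟩
      have h2 : p (σ (1 - t)) = φ.symm (c t y) := by simpa using this
      exact h2

/-- The range is open because coverings are open maps. It is closed because a point with empty fibre
has an evenly covered neighbourhood, over which all fibres are empty. -/
theorem _root_.IsCoveringMap.surjective_of_preconnectedSpace {E X : Type*} [TopologicalSpace E]
    [TopologicalSpace X] [PreconnectedSpace X] [Nonempty E] {p : E → X} (hp : IsCoveringMap p) :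
    Function.Surjective p := by
  refine range_eq_univ.mp (IsClopen.eq_univ ⟨⟨?_⟩, hp.isOpenMap.isOpen_range⟩ (range_nonempty p))
  rw [isOpen_iff_mem_nhds]
  intro x hx
  obtain ⟨-, U, hxU, hU, -, H, -⟩ := hp x
  filter_upwards [hU.mem_nhds hxU] with y hy
  rintro ⟨z, rfl⟩
  exact hx ⟨(H ⟨z, hy⟩).2, (H ⟨z, hy⟩).2.2⟩

variable {S : Type*} [TopologicalSpace S] [ChartedSpace (EuclideanSpace ℝ (Fin n)) S]

/-- Short paths downstairs lift to short paths upstairs. -/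
theorem LiftsSmoothPaths.exists_metricEDist_lt {g : TangentMetric n M} {h : TangentMetric n S}
    {r : S → M} (hl : LiftsSmoothPaths n r) (hr : IsLocalDiffeomorph (𝓡 n) (𝓡 n) ∞ r)
    (hle : ∀ s v, h.inner s v v ≤ pullTensor g r s v v) {s : S} {y : M} {c : ℝ≥0∞}
    (hc : metricEDist g (r s) y < c) : ∃ s', r s' = y ∧ metricEDist h s s' < c := by
  obtain ⟨γ, h0, rfl, hγ, hlen⟩ := exists_metricLength_lt g hc
  obtain ⟨σ, hσ⟩ := hl γ hγ s h0.symm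
  refine ⟨σ 1, hσ.lifts 1 (by simp), ?_⟩
  conv_lhs => rw [← hσ.zero]
  refine (metricEDist_le_metricLength h (hσ.contMDiffOn hr hγ) zero_le_one).trans_lt ?_
  exact (hσ.metricLength_le hr hle hγ subset_rfl).trans_lt hlen

/-- A Cauchy sequence with a convergent subsequence converges. -/
theorem tendsto_metricEDist_of_subseq (g : TangentMetric n M) {s : ℕ → M}
    (hs : ∀ ε : ℝ≥0∞, 0 < ε → ∃ N : ℕ, ∀ i ≥ N, ∀ j ≥ N, metricEDist g (s i) (s j) < ε)
    {k : ℕ → ℕ} (hk : Tendsto k atTop atTop) {x : M}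
    (hx : Tendsto (fun i => metricEDist g (s (k i)) x) atTop (𝓝 0)) :
    Tendsto (fun i => metricEDist g (s i) x) atTop (𝓝 0) := by
  rw [ENNReal.tendsto_nhds_zero]
  intro ε hε
  obtain ⟨N, hN⟩ := hs (ε / 2) (ENNReal.half_pos hε.ne')
  obtain ⟨m, hm1, hm2⟩ := ((hx.eventually (gt_mem_nhds (ENNReal.half_pos hε.ne'))).and
    (hk.eventually_ge_atTop N)).exists
  filter_upwards [eventually_ge_atTop N] with i hi
  calc metricEDist g (s i) x ≤ metricEDist g (s i) (s (k m)) + metricEDist g (s (k m)) x :=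
        metricEDist_triangle _ _ _ _
    _ ≤ ε / 2 + ε / 2 := add_le_add (hN i hi _ hm2).le hm1.le
    _ = ε := ENNReal.add_halves ε

/-- Completeness descends along a surjective local diffeomorphism which lifts `C¹` paths to paths
which are not longer. -/
theorem IsCompleteMetric.of_liftsSmoothPaths {g : TangentMetric n M} {h : TangentMetric n S}
    {r : S → M} (hh : IsCompleteMetric h) (hl : LiftsSmoothPaths n r)
    (hsurj : Function.Surjective r) (hr : IsLocalDiffeomorph (𝓡 n) (𝓡 n) ∞ r)
    (hle : ∀ s v, h.inner s v v ≤ pullTensor g r s v v)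
    (hlim : ∀ (s : ℕ → S) (x : S), Tendsto (fun i => metricEDist h (s i) x) atTop (𝓝 0) →
      Tendsto (fun i => metricEDist g (r (s i)) (r x)) atTop (𝓝 0)) : IsCompleteMetric g := by
  rw [isCompleteMetric_iff]
  intro s hs
  have hpos : ∀ i : ℕ, (0 : ℝ≥0∞) < (1 / 2) ^ i := fun i => ENNReal.pow_pos (by simp) i
  choose N hN using fun i : ℕ => hs ((1 / 2) ^ i) (hpos i)
  -- a subsequence with summable distances
  let k : ℕ → ℕ := fun i => i + ∑ j ∈ Finset.range (i + 1), N j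
  -- The sum in `k` dominates every `N i` and is monotone; the summand `i` forces `k` to infinity.
  have hkN : ∀ i, N i ≤ k i := fun i =>
    (Finset.single_le_sum (fun _ _ => Nat.zero_le _) (Finset.self_mem_range_succ i)).trans
      (Nat.le_add_left _ _)
  have hkmono : ∀ i, k i ≤ k (i + 1) := fun i => by
    simp only [k, Finset.sum_range_succ]
    omega
  have hk : Tendsto k atTop atTop := tendsto_atTop_mono (fun i => Nat.le_add_right _ _) tendsto_id
  have hd : ∀ i, metricEDist g (s (k i)) (s (k (i + 1))) < (1 / 2) ^ i := fun i =>
    hN i _ (hkN i) _ ((hkN i).trans (hkmono i))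
  have hstep : ∀ (i : ℕ) (a : {a : S // r a = s (k i)}),
      ∃ b : {b : S // r b = s (k (i + 1))}, metricEDist h a b < (1 / 2) ^ i := by
    rintro i ⟨a, ha⟩
    obtain ⟨b, hb, hab⟩ := hl.exists_metricEDist_lt hr hle (s := a) (y := s (k (i + 1)))
      (by rw [ha]; exact hd i)
    exact ⟨⟨b, hb⟩, hab⟩
  choose f hf using hstep
  obtain ⟨a0, ha0⟩ := hsurj (s (k 0))
  -- Lift the subsequence point by point, each time along a path of length below `(1 / 2) ^ i`.
  let a : ∀ i, {a : S // r a = s (k i)} := fun i => Nat.rec ⟨a0, ha0⟩ (fun i b => f i b) i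
  have hsum : ∀ i m, metricEDist h (a i).1 (a (i + m)).1 ≤
      ∑ j ∈ Finset.range m, (1 / 2 : ℝ≥0∞) ^ (i + j) := by
    intro i m
    induction m with
    | zero => simp [metricEDist_self]
    | succ m ih =>
      rw [Finset.sum_range_succ]
      exact (metricEDist_triangle h _ (a (i + m)).1 _).trans (add_le_add ih (hf _ (a (i + m))).le)
  have hbd : ∀ i m, metricEDist h (a i).1 (a (i + m)).1 ≤ (1 / 2 : ℝ≥0∞) ^ i * 2 := by
    intro i m
    refine (hsum i m).trans ?_
    simp_rw [pow_add, ← Finset.mul_sum]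
    gcongr
    refine (ENNReal.sum_le_tsum _).trans ?_
    rw [ENNReal.tsum_geometric]
    simp
  have hlim0 : Tendsto (fun i : ℕ => (1 / 2 : ℝ≥0∞) ^ i * 2) atTop (𝓝 0) := by
    have h1 := ENNReal.tendsto_pow_atTop_nhds_zero_of_lt_one (r := 1 / 2)
      (by simp)
    simpa using ENNReal.Tendsto.mul_const h1 (Or.inr (by simp : (2 : ℝ≥0∞) ≠ ⊤))
  obtain ⟨x, hx⟩ := (isCompleteMetric_iff h).mp hh (fun i => (a i).1) (by
    intro ε hε
    obtain ⟨L, hL⟩ := (hlim0.eventually (gt_mem_nhds hε)).exists_forall_of_atTop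
    have key : ∀ i j, L ≤ i → i ≤ j → metricEDist h (a i).1 (a j).1 < ε := by
      intro i j hi hij
      obtain ⟨m, rfl⟩ := Nat.exists_eq_add_of_le hij
      exact (hbd i m).trans_lt (hL i hi)
    refine ⟨L, fun i hi j hj => ?_⟩
    rcases le_total i j with hij | hij
    · exact key i j hi hij
    · rw [metricEDist_comm]
      exact key j i hj hij)
  refine ⟨r x, tendsto_metricEDist_of_subseq g hs hk ?_⟩
  have := hlim _ x hx
  simp_rw [(a _).2] at this
  exact this

/-- Completeness lifts to Riemannian coverings. -/
theorem IsCompleteMetric.of_isCoveringMap [IsManifold (𝓡 n) 1 M] [T2Space M]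
    {g : TangentMetric n M} {h : TangentMetric n S} {r : S → M} (hg : IsCompleteMetric g)
    (hgc : IsContinuousMetric g) (hcov : IsCoveringMap r)
    (hr : IsLocalDiffeomorph (𝓡 n) (𝓡 n) ∞ r)
    (heq : ∀ s v, h.inner s v v = pullTensor g r s v v) : IsCompleteMetric h := by
  rw [isCompleteMetric_iff]
  intro s hs
  have hlip := metricEDist_map_le hr.contMDiff (fun s v => (heq s v).ge)
  obtain ⟨x, hx⟩ := (isCompleteMetric_iff g).mp hg (fun i => r (s i)) fun ε hε => by
    obtain ⟨N, hN⟩ := hs ε hε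
    exact ⟨N, fun i hi j hj => (hlip _ _).trans_lt (hN i hi j hj)⟩
  obtain ⟨hdisc, U, hxU, hU, -, H, hH⟩ := hcov x
  obtain ⟨c, hc, hcU⟩ := hgc.exists_ball_subset (hU.mem_nhds hxU)
  -- distinct points of the fibre have distance at least `c`
  have hfib : ∀ y z, r y = x → r z = x → metricEDist h y z < c → y = z := by
    intro y z hy hz hyz
    obtain ⟨σ, hσ0, hσ1, hσ, hlen⟩ := exists_metricLength_lt h hyz
    have hmem : ∀ t ∈ Icc (0 : ℝ) 1, σ t ∈ r ⁻¹' U := by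
      intro t ht
      refine hcU _ ?_
      have hσt := hσ.mono (Icc_subset_Icc_right ht.2)
      rw [← hy, ← hσ0]
      refine (hlip _ _).trans_lt (lt_of_le_of_lt ?_ hlen)
      exact (metricEDist_le_metricLength h hσt ht.1).trans (metricLength_mono h σ le_rfl ht.2)
    -- The sheet containing the path: a continuous map from an interval to a discrete space, hence
    -- constant.
    let τ : Icc (0 : ℝ) 1 → r ⁻¹' {x} := fun t => (H ⟨σ t, hmem t t.2⟩).2
    have hτ : Continuous τ := by
      have : Continuous fun t : Icc (0 : ℝ) 1 => (⟨σ t, hmem t t.2⟩ : r ⁻¹' U) :=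
        (hσ.continuousOn.domRestrict).subtype_mk _
      fun_prop
    have hconst : τ ⟨0, by simp⟩ = τ ⟨1, by simp⟩ := PreconnectedSpace.constant inferInstance hτ
    have hpt : (⟨σ 0, hmem 0 (by simp)⟩ : r ⁻¹' U) = ⟨σ 1, hmem 1 (by simp)⟩ := by
      refine H.injective (Prod.ext (Subtype.ext ?_) hconst)
      rw [hH, hH]
      simp [hσ0, hσ1, hy, hz]
    rw [← hσ0, ← hσ1]
    exact congrArg Subtype.val hpt
  have hnear : ∀ ε : ℝ≥0∞, 0 < ε → ∃ N : ℕ, ∀ i ≥ N, ∃ y, r y = x ∧ metricEDist h (s i) y < ε := by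
    intro ε hε
    obtain ⟨N, hN⟩ := (hx.eventually (gt_mem_nhds hε)).exists_forall_of_atTop
    exact ⟨N, fun i hi => hcov.liftsSmoothPaths.exists_metricEDist_lt hr (fun s v => (heq s v).le)
      (hN i hi)⟩
  -- Two fibre points are compared through `s N` and `s i`, giving three distances, each below a
  -- third of the separation `c`. So every late term is close to the same fibre point `y`.
  have hc3 : 0 < c / 3 := ENNReal.div_pos hc.ne' (by simp)
  obtain ⟨N₁, hN₁⟩ := hs (c / 3) hc3
  obtain ⟨N₂, hN₂⟩ := hnear (c / 3) hc3
  let N := max N₁ N₂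
  obtain ⟨y, hy, hyd⟩ := hN₂ N (le_max_right _ _)
  refine ⟨y, ENNReal.tendsto_nhds_zero.mpr fun ε hε => ?_⟩
  obtain ⟨N₃, hN₃⟩ := hnear (min ε (c / 3)) (lt_min hε hc3)
  filter_upwards [eventually_ge_atTop (max N N₃)] with i hi
  obtain ⟨z, hz, hzd⟩ := hN₃ i ((le_max_right _ _).trans hi)
  have hyz : y = z := by
    refine hfib y z hy hz ?_
    have hNi := hN₁ N (le_max_left _ _) i ((le_max_left _ _).trans ((le_max_left _ _).trans hi))
    calc metricEDist h y z
        ≤ metricEDist h y (s N) + (metricEDist h (s N) (s i) + metricEDist h (s i) z) :=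
          (metricEDist_triangle h _ (s N) _).trans
            (add_le_add le_rfl (metricEDist_triangle h _ (s i) _))
      _ < c / 3 + (c / 3 + c / 3) :=
          ENNReal.add_lt_add (by rwa [metricEDist_comm])
            (ENNReal.add_lt_add hNi (hzd.trans_le (min_le_right _ _)))
      _ = c := by rw [← add_assoc, ENNReal.add_thirds]
  rw [hyz]
  exact (hzd.trans_le (min_le_left _ _)).le

end Covering

/-! ### Lifts of the hypersurface to universal coverings. -/

section Lifts

open Set Filter

variable {n : ℕ} {M : Type*} [TopologicalSpace M] [ChartedSpace (EuclideanSpace ℝ (Fin n)) M]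
  {S : Type*} [TopologicalSpace S] [ChartedSpace (EuclideanSpace ℝ (Fin n)) S]
  {M' : Type*} [TopologicalSpace M'] [ChartedSpace (EuclideanSpace ℝ (Fin n)) M']
  {S' : Type*} [TopologicalSpace S'] [ChartedSpace (EuclideanSpace ℝ (Fin n)) S']

theorem IsLift.fst_comp {M S M' S' : Type*} [TopologicalSpace M'] [TopologicalSpace S']
    {F : S → M × ℝ} {q : S' → S} {p : M' → M} {G : S' → M' × ℝ}
    (h : IsLift F q p G) : p ∘ (fun s => (G s).1) = (fun s => (F s).1) ∘ q :=
  funext fun s => congrArg Prod.fst (h.comm s)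

theorem IsLift.snd_comp {M S M' S' : Type*} [TopologicalSpace M'] [TopologicalSpace S']
    {F : S → M × ℝ} {q : S' → S} {p : M' → M} {G : S' → M' × ℝ}
    (h : IsLift F q p G) : (fun s => (G s).2) = (fun s => (F s).2) ∘ q :=
  funext fun s => congrArg Prod.snd (h.comm s)

theorem pullTensor_pullbackMetric {p : M' → M} (hp : IsUniversalCovering n p) (g : TangentMetric n M)
    {f : S' → M'} {s : S'} (hf : MDifferentiableAt (𝓡 n) (𝓡 n) f s) (v w : TangentSpace (𝓡 n) s) :
    pullTensor (hp.pullbackMetric g) f s v w = pullTensor g (p ∘ f) s v w :=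
  (pullTensor_comp g (hp.isLocalDiffeomorph.contMDiff.mdifferentiable (by simp) _) hf v w).symm

section

variable {g : TangentMetric n M} {F : S → M × ℝ} (hF : IsSpacelikeImmersion g F) {q : S' → S}
  (hq : IsLocalDiffeomorph (𝓡 n) (𝓡 n) ∞ q) {p : M' → M} (hp : IsUniversalCovering n p)
  {G : S' → M' × ℝ} (hG : IsLift F q p G)
include hF hq hp hG

/-- The first component is a continuous lift of a smooth map through the local diffeomorphism `p`;
the second is the height composed with `q`. -/
theorem IsLift.contMDiff : ContMDiff (𝓡 n) ((𝓡 n).prod 𝓘(ℝ, ℝ)) ∞ G := by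
  refine ContMDiff.prodMk (f := fun s => (G s).1) (g := fun s => (G s).2) ?_ ?_
  · refine contMDiff_of_comp_isLocalDiffeomorph hp.isLocalDiffeomorph le_rfl
      (continuous_fst.comp hG.continuous) ?_
    rw [hG.fst_comp]
    exact hF.contMDiff_fst.comp hq.contMDiff
  · rw [hG.snd_comp]
    exact hF.contMDiff_snd.comp hq.contMDiff

/-- The form induced by a lift is the pullback of the form induced by the original immersion. -/
theorem IsLift.inducedForm_eq (s : S') (v w : TangentSpace (𝓡 n) s) :
    inducedForm (hp.pullbackMetric g) G s v w = pullTensor hF.inducedMetric q s v w := by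
  have hGs := hG.contMDiff hF hq hp
  have hqs : MDifferentiableAt (𝓡 n) (𝓡 n) q s := hq.contMDiff.mdifferentiable (by simp) s
  have hG1 : MDifferentiableAt (𝓡 n) (𝓡 n) (fun s => (G s).1) s :=
    (contMDiff_fst.comp hGs).mdifferentiable (by simp) s
  rw [inducedForm_apply _ (hGs.mdifferentiable (by simp) s), pullTensor_pullbackMetric hp g hG1,
    hG.fst_comp, hG.snd_comp, pullTensor_comp g (hF.contMDiff_fst.mdifferentiable (by simp) _) hqs,
    realDiff_comp (hF.contMDiff_snd.mdifferentiable (by simp) _) hqs,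
    realDiff_comp (hF.contMDiff_snd.mdifferentiable (by simp) _) hqs]
  exact (hF.inducedMetric_apply (q s) _ _).symm

/-- A lift of a spacelike immersion is a spacelike immersion. -/
theorem IsLift.isSpacelikeImmersion : IsSpacelikeImmersion (hp.pullbackMetric g) G := by
  have hpos : ∀ (s : S') (v : TangentSpace (𝓡 n) s), v ≠ 0 →
      0 < inducedForm (hp.pullbackMetric g) G s v v := by
    intro s v hv
    rw [hG.inducedForm_eq hF hq hp]
    refine hF.inducedMetric.pos _ _ fun h => hv ?_
    rw [← hq.mfderivToContinuousLinearEquiv_coe (by simp) s] at h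
    exact (ContinuousLinearEquiv.map_eq_zero_iff _).mp h
  refine ⟨hG.contMDiff hF hq hp, fun s => ?_, hpos⟩
  rw [injective_iff_map_eq_zero]
  intro v hv
  by_contra h
  exact (hpos s v h).ne' (inducedForm_eq_zero_of_mfderiv_eq_zero _ hv)

end

end Lifts

/-- A map between simply connected spaces which covers a covering map is a homeomorphism. -/
theorem exists_inverse_of_comp_eq {M S M' S' : Type*} [TopologicalSpace M] [TopologicalSpace S]
    [TopologicalSpace M'] [TopologicalSpace S'] [LocallyPathConnectedSpace M']
    [SimplyConnectedSpace S'] [SimplyConnectedSpace M']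
    {r : S → M} (hr : IsCoveringMap r) {q : S' → S} (hq : IsCoveringMap q) {p : M' → M}
    (hp : IsCoveringMap p) {f : S' → M'} (hf : Continuous f) (h : p ∘ f = r ∘ q) :
    ∃ k : M' → S', Continuous k ∧ Function.LeftInverse k f ∧ Function.RightInverse k f := by
  obtain ⟨s⟩ : Nonempty S' := inferInstance
  -- The inverse comes from lifting `p` through `r` and then through `q`, with base points arranged
  -- so that `k (f s) = s`. Uniqueness of lifts then identifies both composites with the identity.
  obtain ⟨l, ⟨hl0, hl⟩, -⟩ := hr.existsUnique_continuousMap_lifts ⟨p, hp.continuous⟩ (f s) (q s)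
    (congrFun h s).symm
  obtain ⟨k, ⟨hk0, hk⟩, -⟩ := hq.existsUnique_continuousMap_lifts l (f s) s hl0.symm
  have hrqk : r ∘ q ∘ k = p := by rw [hk]; exact hl
  have hqkf : q ∘ k ∘ f = q := by
    refine hr.eq_of_comp_eq (hq.continuous.comp (k.continuous.comp hf)) hq.continuous ?_ s
      (congrArg q hk0)
    rw [← h, ← hrqk]
    rfl
  refine ⟨k, k.continuous, congrFun ?_, congrFun ?_⟩
  · exact hq.eq_of_comp_eq (k.continuous.comp hf) continuous_id hqkf s hk0
  · refine hp.eq_of_comp_eq (hf.comp k.continuous) continuous_id ?_ (f s) (congrArg f hk0)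
    exact (congrArg (· ∘ k) h).trans hrqk

/-- A smooth Riemannian metric is continuous. -/
theorem isContinuousMetric_toRiemannianMetric {n : ℕ} {M : Type*} [TopologicalSpace M]
    [ChartedSpace (EuclideanSpace ℝ (Fin n)) M] [IsManifold (𝓡 n) ∞ M]
    (gM : Bundle.ContMDiffRiemannianMetric (𝓡 n) ∞ (EuclideanSpace ℝ (Fin n))
      (fun x : M => TangentSpace (𝓡 n) x)) : IsContinuousMetric gM.toRiemannianMetric :=
  let : Bundle.RiemannianBundle (fun x : M => TangentSpace (𝓡 n) x) := ⟨gM.toRiemannianMetric⟩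
  ⟨gM.inner, gM.contMDiff.continuous, fun _ _ _ => rfl⟩

end LorentzProduct
end

/-! ### The proposition. -/

theorem proposition3p3 {n : ℕ}
    {M : Type*} [TopologicalSpace M] [ChartedSpace (EuclideanSpace ℝ (Fin n)) M]
    [IsManifold (𝓡 n) ∞ M] [T2Space M] [ConnectedSpace M]
    (gM : Bundle.ContMDiffRiemannianMetric (𝓡 n) ∞ (EuclideanSpace ℝ (Fin n))
      (fun x : M => TangentSpace (𝓡 n) x))
    {S : Type*} [TopologicalSpace S] [ChartedSpace (EuclideanSpace ℝ (Fin n)) S]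
    [IsManifold (𝓡 n) ∞ S] [T2Space S] [Nonempty S]
    (F : S → M × ℝ) (hF : LorentzProduct.IsSpacelikeImmersion gM.toRiemannianMetric F) :
    (¬ LorentzProduct.IsCompleteMetric gM.toRiemannianMetric →
      ¬ LorentzProduct.IsCompleteMetric hF.inducedMetric) ∧
    (LorentzProduct.IsCompleteMetric gM.toRiemannianMetric → IsProperMap F →
      (IsCoveringMap (fun s => (F s).1) ∧ Function.Surjective (fun s => (F s).1) ∧
        IsLocalDiffeomorph (𝓡 n) (𝓡 n) ∞ (fun s => (F s).1)) ∧
      ∀ {M' : Type*} [TopologicalSpace M'] [ChartedSpace (EuclideanSpace ℝ (Fin n)) M']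
        [IsManifold (𝓡 n) ∞ M'] [T2Space M']
        {S' : Type*} [TopologicalSpace S'] [ChartedSpace (EuclideanSpace ℝ (Fin n)) S']
        [IsManifold (𝓡 n) ∞ S'] [T2Space S']
        (p : M' → M) (hp : LorentzProduct.IsUniversalCovering n p)
        (q : S' → S) (_hq : LorentzProduct.IsUniversalCovering n q),
        (∃ G : S' → M' × ℝ, LorentzProduct.IsLift F q p G) ∧
        ∀ G : S' → M' × ℝ, LorentzProduct.IsLift F q p G →
          LorentzProduct.IsSpacelikeImmersion (hp.pullbackMetric gM.toRiemannianMetric) G ∧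
          (∃ Φ : S' ≃ₘ^∞⟮𝓡 n, 𝓡 n⟯ M', ∀ s, (G s).1 = Φ s) ∧
          ∃ (u : M' → ℝ)
            (hu : LorentzProduct.IsSpacelikeImmersion (hp.pullbackMetric gM.toRiemannianMetric)
              (fun x => (x, u x))),
            Set.range G = {z : M' × ℝ | z.2 = u z.1} ∧
            (LorentzProduct.IsCompleteMetric hF.inducedMetric ↔
              LorentzProduct.IsCompleteMetric hu.inducedMetric)) := by
  have hgc := LorentzProduct.isContinuousMetric_toRiemannianMetric gM
  have hhc := hF.isContinuousMetric hgc
  have hloc := hF.isLocalDiffeomorph_fst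
  refine ⟨fun hinc hcomp => hinc ?_, fun _ hprop => ?_⟩
  · have hl := LorentzProduct.liftsSmoothPaths_of_isCompleteMetric hloc hF.inducedMetric_le hgc hhc
      hcomp
    have hcov := hl.isCoveringMap hloc.isLocalHomeomorph
    exact hcomp.of_liftsSmoothPaths hl hcov.surjective_of_preconnectedSpace hloc
      hF.inducedMetric_le fun s x hx => hgc.tendsto_metricEDist
        ((hcov.continuous.tendsto x).comp (hhc.tendsto_nhds hx))
  have hl := hF.liftsSmoothPaths hgc hprop
  have hcov := hl.isCoveringMap hloc.isLocalHomeomorph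
  refine ⟨⟨hcov, hcov.surjective_of_preconnectedSpace, hloc⟩, ?_⟩
  intro M' _ _ _ _ S' _ _ _ _ p hp q hq
  have := hp.simplyConnected
  have := hq.simplyConnected
  refine ⟨?_, fun G hG => ?_⟩
  · have : LocallyPathConnectedSpace S' :=
      ChartedSpace.locallyPathConnectedSpace (EuclideanSpace ℝ (Fin n)) S'
    obtain ⟨s⟩ : Nonempty S' := inferInstance
    obtain ⟨x, hx⟩ := hp.surjective (F (q s)).1
    -- Only the first component needs lifting, through `p`; the height is kept.
    obtain ⟨f, ⟨-, hf⟩, -⟩ := hp.isCoveringMap.existsUnique_continuousMap_lifts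
      ⟨_, hcov.continuous.comp hq.isCoveringMap.continuous⟩ s x hx
    exact ⟨fun s => (f s, (F (q s)).2), f.continuous.prodMk
      (hF.contMDiff_snd.continuous.comp hq.isCoveringMap.continuous),
      fun s => Prod.ext (congrFun hf s) rfl⟩
  have : LocallyPathConnectedSpace M' :=
    ChartedSpace.locallyPathConnectedSpace (EuclideanSpace ℝ (Fin n)) M'
  have hGs := hG.isSpacelikeImmersion hF hq.isLocalDiffeomorph hp
  obtain ⟨k, hk, hkl, hkr⟩ := LorentzProduct.exists_inverse_of_comp_eq hcov
    hq.isCoveringMap hp.isCoveringMap hGs.contMDiff_fst.continuous hG.fst_comp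
  -- The inverse is a continuous lift of the identity through the first component of `G`, which is a
  -- local diffeomorphism.
  have hks : ContMDiff (𝓡 n) (𝓡 n) ∞ k :=
    LorentzProduct.contMDiff_of_comp_isLocalDiffeomorph hGs.isLocalDiffeomorph_fst le_rfl hk
      (contMDiff_id.congr hkr)
  let Φ : S' ≃ₘ^∞⟮𝓡 n, 𝓡 n⟯ M' :=
    { toFun := fun s => (G s).1
      invFun := k
      left_inv := hkl
      right_inv := hkr
      contMDiff_toFun := hGs.contMDiff_fst
      contMDiff_invFun := hks }
  have hqk : IsLocalDiffeomorph (𝓡 n) (𝓡 n) ∞ (q ∘ k) := fun x =>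
    (Φ.symm.isLocalDiffeomorph x).comp (hg := hq.isLocalDiffeomorph (k x))
  have hqkc : IsCoveringMap (q ∘ k) := hq.isCoveringMap.comp_homeomorph Φ.symm.toHomeomorph
  -- The graph map is `G ∘ k`, hence again a lift of `F`, now along `q ∘ k`. The results on lifts
  -- make it spacelike and its metric the pullback of that of `S`.
  have hlift : LorentzProduct.IsLift F (q ∘ k) p (fun x => (x, (G (k x)).2)) := by
    refine ⟨continuous_id.prodMk (continuous_snd.comp (hG.continuous.comp hk)), fun x => ?_⟩
    refine Eq.trans ?_ (hG.comm (k x))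
    exact Prod.ext (congrArg p (hkr x).symm) rfl
  have hu := hlift.isSpacelikeImmersion hF hqk hp
  have heq : ∀ x v, hu.inducedMetric.inner x v v =
      LorentzProduct.pullTensor hF.inducedMetric (q ∘ k) x v v := fun x v =>
    hlift.inducedForm_eq hF hqk hp x v v
  refine ⟨hGs, ⟨Φ, fun _ => rfl⟩, fun x => (G (k x)).2, hu, ?_, fun hc => ?_, fun hc => ?_⟩
  · ext z
    constructor
    · rintro ⟨s, rfl⟩
      exact congrArg (fun a => (G a).2) (hkl s).symm
    · exact fun hz => ⟨k z.1, Prod.ext (hkr z.1) (Eq.symm hz)⟩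
  · exact hc.of_isCoveringMap hhc hqkc hqk heq
  -- Here `q ∘ k` pulls the metric back exactly, so it does not increase distances, and convergence
  -- descends at once.
  · refine hc.of_liftsSmoothPaths hqkc.liftsSmoothPaths (hq.surjective.comp Φ.symm.surjective) hqk
      (fun x v => (heq x v).le) fun s x hx => ?_
    exact tendsto_of_tendsto_of_tendsto_of_le_of_le tendsto_const_nhds hx (fun _ => zero_le)
      fun _ => LorentzProduct.metricEDist_map_le hqk.contMDiff (fun x v => (heq x v).ge) _ _
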